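/- Let $n\ge 3$, let $M$ be a smooth $n$-dimensional manifold with a smooth Riemannian metric $\bar\alpha$ (components $\bar a_{ij}$), let $\bar\beta$ be a smooth $1$-form on $M$, and let $c\in\mathbb R$ be a constant. Let $\bar\beta_{i|j}$ denote the components of the covariant derivative of $\bar\beta$ with respect to the Levi-Civita connection of $\bar\alpha$. For $p\in M$ and $d\in\mathbb R$ with $c^2+d^2\neq 0$, say that $(\bar\alpha,\bar\beta)$ is of the form $(\ast)_{c,d}$ around $p$ if some open neighborhood of $p$ is diffeomorphic to a product $J\times\breve M$, where $J\subset\mathbb R$ is an open interval with coordinate $t$ and $\breve M$ is a smooth $(n-1)$-dimensional manifold with a Riemannian metric $\breve\alpha$, such that under this diffeomorphism $$\bar\alpha^2=dt\otimes dt+(ct+d)^2\,\breve\alpha^2,\qquad \bar\beta=(ct+d)\,dt,$$ and $\breve\alpha$ is an Einstein metric with $\mathrm{Ric}(\breve\alpha)=(n-2)c^2\breve\alpha^2$. Then: 1. $\bar\alpha$ is Ricci flat, $\bar\beta_{i|j}=c\,\bar a_{ij}$ on $M$, and $\bar\beta$ has no zeros, if and only if for every $p\in M$ there is a constant $d$ with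 $c^2+d^2\ne0$ such that $(\bar\alpha,\bar\beta)$ is of the form $(\ast)_{c,d}$ around $p$. 2. If $\bar\alpha$ is Ricci flat and $\bar\beta_{i|j}=c\,\bar a_{ij}$ on $M$ (zeros of $\bar\beta$ being allowed), then for every $p\in M$ with $\bar\beta_p\neq0$ there is a constant $d$ with $c^2+d^2\ne0$ such that $(\bar\alpha,\bar\beta)$ is of the form $(\ast)_{c,d}$ around $p$. If moreover $M$ is connected, a single constant $d$ can be chosen for all such points $p$. -/

import Mathlib

open scoped Manifold ContDiff
open Bundle

noncomputable section

/-! ### Tensor calculus in coordinates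

`G x` is the matrix `(g_{ij}(x))` of a metric and `b i x` is the component `b_i(x)` of a 1-form,
both in the coordinates of `EuclideanSpace ℝ (Fin n)`. -/

/-- The partial derivative `∂f/∂xᵏ` at `x`. -/
def partialD {n : ℕ} (k : Fin n) (f : EuclideanSpace ℝ (Fin n) → ℝ)
    (x : EuclideanSpace ℝ (Fin n)) : ℝ :=
  fderiv ℝ f x (EuclideanSpace.single k 1)

/-- The Christoffel symbol
`Γᵏ_{ij} = ½ ∑ₗ gᵏˡ (∂ᵢ g_{jl} + ∂ⱼ g_{il} - ∂ₗ g_{ij})` of the Levi-Civita connection. -/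
def christoffel {n : ℕ} (G : EuclideanSpace ℝ (Fin n) → Matrix (Fin n) (Fin n) ℝ)
    (k i j : Fin n) (x : EuclideanSpace ℝ (Fin n)) : ℝ :=
  (1 / 2 : ℝ) * ∑ l, (G x)⁻¹ k l *
    (partialD i (fun y => G y j l) x + partialD j (fun y => G y i l) x
      - partialD l (fun y => G y i j) x)

/-- The Ricci tensor
`R_{ij} = ∂ₖ Γᵏ_{ij} - ∂ⱼ Γᵏ_{ik} + Γᵏ_{kl} Γˡ_{ij} - Γᵏ_{jl} Γˡ_{ik}` (summed over `k`, `l`). -/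
def ricciComp {n : ℕ} (G : EuclideanSpace ℝ (Fin n) → Matrix (Fin n) (Fin n) ℝ)
    (i j : Fin n) (x : EuclideanSpace ℝ (Fin n)) : ℝ :=
  (∑ k, (partialD k (christoffel G k i j) x - partialD j (christoffel G k i k) x))
    + ∑ k, ∑ l, (christoffel G k k l x * christoffel G l i j x
        - christoffel G k j l x * christoffel G l i k x)

/-- The covariant derivative `b_{i|j} = ∂ⱼ bᵢ - ∑ₖ Γᵏ_{ij} bₖ` of a 1-form. -/
def covDerivComp {n : ℕ} (G : EuclideanSpace ℝ (Fin n) → Matrix (Fin n) (Fin n) ℝ)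
    (b : Fin n → EuclideanSpace ℝ (Fin n) → ℝ) (i j : Fin n)
    (x : EuclideanSpace ℝ (Fin n)) : ℝ :=
  partialD j (b i) x - ∑ k, christoffel G k i j x * b k x

/-! ### Riemannian metrics and 1-forms on manifolds -/

/-- A smooth Riemannian metric on the `n`-dimensional manifold `M`. -/
abbrev SmoothMetric (n : ℕ) (M : Type*) [TopologicalSpace M]
    [ChartedSpace (EuclideanSpace ℝ (Fin n)) M] [IsManifold (𝓡 n) ∞ M] :=
  ContMDiffRiemannianMetric (𝓡 n) ∞ (EuclideanSpace ℝ (Fin n))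
    (fun x : M => TangentSpace (𝓡 n) x)

/-- A smooth 1-form on the `n`-dimensional manifold `M`: a smooth section of the cotangent
bundle. -/
structure SmoothOneForm (n : ℕ) (M : Type*) [TopologicalSpace M]
    [ChartedSpace (EuclideanSpace ℝ (Fin n)) M] [IsManifold (𝓡 n) ∞ M] where
  /-- The value at a point, a linear form on the tangent space. -/
  toFun (x : M) : TangentSpace (𝓡 n) x →L[ℝ] ℝ
  contMDiff : ContMDiff (𝓡 n) ((𝓡 n).prod 𝓘(ℝ, EuclideanSpace ℝ (Fin n) →L[ℝ] ℝ)) ∞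
    (fun x : M => TotalSpace.mk' (EuclideanSpace ℝ (Fin n) →L[ℝ] ℝ)
      (E := fun x : M => TangentSpace (𝓡 n) x →L[ℝ] Trivial M ℝ x) x (toFun x))

section Manifold

variable {n : ℕ} {M : Type*} [TopologicalSpace M]
  [ChartedSpace (EuclideanSpace ℝ (Fin n)) M] [IsManifold (𝓡 n) ∞ M]

/-- The coordinate vector `∂/∂xⁱ` of the chart `e`, at the point with coordinates `x`. -/
def coordVec (e : OpenPartialHomeomorph M (EuclideanSpace ℝ (Fin n)))
    (i : Fin n) (x : EuclideanSpace ℝ (Fin n)) : TangentSpace (𝓡 n) (e.symm x) :=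
  mfderiv 𝓘(ℝ, EuclideanSpace ℝ (Fin n)) (𝓡 n) e.symm x
    (EuclideanSpace.single i (1 : ℝ) : EuclideanSpace ℝ (Fin n))

/-- The matrix `g_{ij} = g(∂/∂xⁱ, ∂/∂xʲ)` of a metric in the chart `e`. -/
def metricComp (g : SmoothMetric n M) (e : OpenPartialHomeomorph M (EuclideanSpace ℝ (Fin n)))
    (x : EuclideanSpace ℝ (Fin n)) : Matrix (Fin n) (Fin n) ℝ :=
  Matrix.of fun i j => g.inner (e.symm x) (coordVec e i x) (coordVec e j x)

/-- The components `bᵢ = β(∂/∂xⁱ)` of a 1-form in the chart `e`. -/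
def formComp (β : SmoothOneForm n M) (e : OpenPartialHomeomorph M (EuclideanSpace ℝ (Fin n)))
    (i : Fin n) (x : EuclideanSpace ℝ (Fin n)) : ℝ :=
  β.toFun (e.symm x) (coordVec e i x)

/-- `Ric(g) = κ g` with the constant `κ`: in every smooth chart, `R_{ij} = κ g_{ij}`. -/
def RicciEq (g : SmoothMetric n M) (κ : ℝ) : Prop :=
  ∀ e ∈ IsManifold.maximalAtlas (𝓡 n) ∞ M, ∀ x ∈ e.target, ∀ i j : Fin n,
    ricciComp (metricComp g e) i j x = κ * metricComp g e x i j

/-- The Ricci tensor of `g` vanishes. -/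
def RicciFlat (g : SmoothMetric n M) : Prop :=
  ∀ e ∈ IsManifold.maximalAtlas (𝓡 n) ∞ M, ∀ x ∈ e.target, ∀ i j : Fin n,
    ricciComp (metricComp g e) i j x = 0

/-- `b_{i|j} = c g_{ij}` in every smooth chart, where `|` is the covariant derivative of `g`. -/
def CovDerivEq (g : SmoothMetric n M) (β : SmoothOneForm n M) (c : ℝ) : Prop :=
  ∀ e ∈ IsManifold.maximalAtlas (𝓡 n) ∞ M, ∀ x ∈ e.target, ∀ i j : Fin n,
    covDerivComp (metricComp g e) (formComp β e) i j x = c * metricComp g e x i j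

/-- Around `p`, the manifold is `J × N`, with `J = (s₁, s₂)` an open interval with coordinate `t`
and `N` an `(n-1)`-manifold with a metric `h` satisfying `Ric(h) = (n-2) c² h`, in such a way that
`g = dt² + (c t + d)² h` and `β = (c t + d) dt`. -/
def IsLocalWarpedProductAt (g : SmoothMetric n M) (β : SmoothOneForm n M) (c d : ℝ)
    (p : M) : Prop :=
  ∃ (N : Type) (_ : TopologicalSpace N) (_ : T2Space N) (_ : SecondCountableTopology N)
    (_ : ChartedSpace (EuclideanSpace ℝ (Fin (n - 1))) N) (_ : IsManifold (𝓡 (n - 1)) ∞ N)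
    (h : SmoothMetric (n - 1) N) (s₁ s₂ : ℝ) (Φ : OpenPartialHomeomorph M (ℝ × N)),
    RicciEq h (((n : ℝ) - 2) * c ^ 2) ∧
    p ∈ Φ.source ∧ Φ.target = Set.Ioo s₁ s₂ ×ˢ Set.univ ∧
    ContMDiffOn (𝓡 n) (𝓘(ℝ, ℝ).prod (𝓡 (n - 1))) ∞ Φ Φ.source ∧
    ContMDiffOn (𝓘(ℝ, ℝ).prod (𝓡 (n - 1))) (𝓡 n) ∞ Φ.symm Φ.target ∧
    ∀ q ∈ Φ.source,
      let dt : TangentSpace (𝓡 n) q →L[ℝ] ℝ :=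
        mfderiv (𝓡 n) 𝓘(ℝ, ℝ) (fun z => (Φ z).1) q
      let dπ : TangentSpace (𝓡 n) q →L[ℝ] TangentSpace (𝓡 (n - 1)) (Φ q).2 :=
        mfderiv (𝓡 n) (𝓡 (n - 1)) (fun z => (Φ z).2) q
      (∀ v w : TangentSpace (𝓡 n) q,
        g.inner q v w = dt v * dt w + (c * (Φ q).1 + d) ^ 2 * h.inner (Φ q).2 (dπ v) (dπ w)) ∧
      ∀ v : TangentSpace (𝓡 n) q, β.toFun q v = (c * (Φ q).1 + d) * dt v

end Manifold

end

/-! ### Inverse function theorem and smooth local flows -/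

section SmoothFlow

open Set Filter Topology

/-! Write α, β for the given metric and 1-form, and f = ct + d. The direct implication rests on one
identity: ∇β = cα gives d|β|² = 2cβ (`hasFDerivAt_formNormSq`). If c ≠ 0, then t = |β|/c satisfies β
= ct dt, so d = 0 works everywhere. If c = 0, the norm of β is locally constant; with d² = |β|², a
local primitive of the closed form β/d serves as t. Either way |β|² = f² and β = f dt
(`exists_potential`), hence |dt| = 1.

The gradient of t therefore satisfies dt(grad t) = 1. Straightening it (`exists_flowBox`) gives
coordinates (t, y) in which the metric is dt² + k, with k a family of metrics on the slices
depending on t. On slice vectors ∇β = cα reads f ∂ₜk = 2ck, so k = f²h with h independent of t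
(`exists_eq_warpedMetric`). Because f is affine, the Ricci tensor of dt² + f²h is Ric(h) − (n−2)c²h
on slice vectors and zero otherwise (`ricciForm_warpedMetric`): flatness of the product is exactly
the Einstein condition on h.

The converse reads the same formulas backwards; f ≠ 0 is then forced by positivity of α, since dt
has a nontrivial kernel.

Two supports are needed. Straightening requires smooth dependence of flows on the initial point,
obtained from the inverse function theorem on a space of paths. And since the hypotheses are index
formulas in all charts, Ricci tensor and covariant derivative are rewritten without coordinates and
shown to be preserved by isometries (`IsIsometryOn.ricciForm_eq`, `IsIsometryOn.covDerivForm_eq`).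
-/

/-- The inverse function theorem, with smoothness of the inverse on an open set. -/
theorem exists_openPartialHomeomorph_contDiffOn {E F : Type*} [NormedAddCommGroup E]
    [NormedSpace ℝ E] [CompleteSpace E] [NormedAddCommGroup F] [NormedSpace ℝ F]
    {f : E → F} {U : Set E} (hU : IsOpen U) (hf : ContDiffOn ℝ ∞ f U) {x₀ : E} (hx₀ : x₀ ∈ U)
    (f' : E ≃L[ℝ] F) (hf' : HasFDerivAt f (f' : E →L[ℝ] F) x₀) :
    ∃ e : OpenPartialHomeomorph E F, x₀ ∈ e.source ∧ e.source ⊆ U ∧ (∀ x, e x = f x) ∧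
      ContDiffOn ℝ ∞ e.symm e.target := by
  have hc : ContDiffAt ℝ ∞ f x₀ := hf.contDiffAt (hU.mem_nhds hx₀)
  let e₀ := hc.toOpenPartialHomeomorph f hf' (by simp)
  have hfd : ContinuousOn (fderiv ℝ f) U := hf.continuousOn_fderiv_of_isOpen hU (by simp)
  -- The standard theorem gives smoothness of the inverse only at the image of x₀. Restricting to
  -- the open set where the derivative stays invertible makes it available at every point of the
  -- target.
  let W := U ∩ fderiv ℝ f ⁻¹' range ((↑) : (E ≃L[ℝ] F) → E →L[ℝ] F)
  have hW : IsOpen W := hfd.isOpen_inter_preimage hU ContinuousLinearEquiv.isOpen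
  refine ⟨e₀.restrOpen W hW, ⟨hc.mem_toOpenPartialHomeomorph_source hf' (by simp), hx₀, f',
    hf'.fderiv.symm⟩, fun x hx => hx.2.1, fun x => rfl, ?_⟩
  intro y hy
  have hyW := (e₀.restrOpen W hW).map_target hy
  obtain ⟨hyU, g, hg⟩ := hyW.2
  have hcy : ContDiffAt ℝ ∞ f ((e₀.restrOpen W hW).symm y) := hf.contDiffAt (hU.mem_nhds hyU)
  refine (OpenPartialHomeomorph.contDiffAt_symm (e₀.restrOpen W hW) hy (f₀' := g) ?_
    hcy).contDiffWithinAt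
  rw [hg]
  exact (hcy.differentiableAt (by simp)).hasFDerivAt

universe u

set_option maxSynthPendingDepth 3

/-- Pointwise application of a continuous family of linear maps to a continuous function. -/
noncomputable def pointwiseApplyCLM (K : Type*) [TopologicalSpace K] [CompactSpace K]
    (E F : Type*) [NormedAddCommGroup E] [NormedSpace ℝ E] [NormedAddCommGroup F]
    [NormedSpace ℝ F] : C(K, E →L[ℝ] F) →L[ℝ] C(K, E) →L[ℝ] C(K, F) :=
  LinearMap.mkContinuous₂
    (LinearMap.mk₂ ℝ (fun (A : C(K, E →L[ℝ] F)) (h : C(K, E)) =>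
        (⟨fun s => A s (h s), A.continuous.clm_apply h.continuous⟩ : C(K, F)))
      (fun _ _ _ => by ext; simp) (fun _ _ _ => by ext; simp)
      (fun _ _ _ => by ext; simp) (fun _ _ _ => by ext; simp)) 1 (by
    intro A h
    rw [ContinuousMap.norm_le _ (by positivity)]
    intro s
    simp only [LinearMap.mk₂_apply, ContinuousMap.coe_mk, one_mul]
    exact (A s).le_of_opNorm_le_of_le (A.norm_coe_le_norm s) (h.norm_coe_le_norm s))

/-- In the sup norm the remainder must be small uniformly along γ. Compact support makes `fderiv ℝ
V` uniformly continuous, and the mean value inequality on balls of one radius δ then gives the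
bound. -/
theorem hasFDerivAt_postcomp {K : Type*} [TopologicalSpace K] [CompactSpace K]
    {E F : Type*} [NormedAddCommGroup E] [NormedSpace ℝ E] [NormedAddCommGroup F]
    [NormedSpace ℝ F] {V : E → F} (hV : ContDiff ℝ 1 V) (hc : HasCompactSupport V)
    (γ : C(K, E)) :
    HasFDerivAt (fun γ : C(K, E) => (⟨V, hV.continuous⟩ : C(E, F)).comp γ)
      (pointwiseApplyCLM K E F
        ((⟨fderiv ℝ V, hV.continuous_fderiv (by simp)⟩ : C(E, E →L[ℝ] F)).comp γ)) γ := by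
  have hu : UniformContinuous (fderiv ℝ V) :=
    (hc.fderiv ℝ).uniformContinuous_of_continuous (hV.continuous_fderiv (by simp))
  rw [hasFDerivAt_iff_isLittleO_nhds_zero, Asymptotics.isLittleO_iff]
  intro ε hε
  obtain ⟨δ, hδ, hδε⟩ := Metric.uniformContinuous_iff.1 hu ε hε
  filter_upwards [Metric.ball_mem_nhds (0 : C(K, E)) hδ] with h hh
  rw [ContinuousMap.norm_le _ (by positivity)]
  intro s
  have hs : ‖h s‖ ≤ ‖h‖ := h.norm_coe_le_norm s
  have hball : ∀ z ∈ Metric.ball (γ s) δ, ‖fderiv ℝ V z - fderiv ℝ V (γ s)‖ ≤ ε := fun z hz => by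
    rw [← dist_eq_norm]; exact (hδε hz).le
  have := (convex_ball (γ s) δ).norm_image_sub_le_of_norm_fderiv_le'
    (fun z _ => hV.differentiable (by simp) z) hball (Metric.mem_ball_self hδ)
    (y := γ s + h s) (by
      rw [mem_ball_iff_norm, add_sub_cancel_left]
      exact hs.trans_lt (by simpa using hh))
  rw [add_sub_cancel_left] at this
  exact this.trans (mul_le_mul_of_nonneg_left hs hε.le)

/-- Composition with a compactly supported smooth map is a smooth operation on continuous
functions. -/
theorem contDiff_postcomp {K : Type*} [TopologicalSpace K] [CompactSpace K]
    {E : Type u} [NormedAddCommGroup E] [NormedSpace ℝ E] (k : ℕ)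
    {F : Type u} [NormedAddCommGroup F] [NormedSpace ℝ F] {V : E → F}
    (hV : ContDiff ℝ ∞ V) (hc : HasCompactSupport V) :
    ContDiff ℝ k (fun γ : C(K, E) => (⟨V, hV.continuous⟩ : C(E, F)).comp γ) := by
  -- F varies because the derivative is again built from a post-composition, by `fderiv ℝ V`, whose
  -- values lie in another space.
  induction k generalizing F with
  | zero => exact contDiff_zero.2 (ContinuousMap.continuous_postcomp _)
  | succ k ih =>
    have hd := hasFDerivAt_postcomp (K := K) (hV.of_le (by simp)) hc
    push_cast
    rw [contDiff_succ_iff_fderiv]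
    refine ⟨fun γ => (hd γ).differentiableAt, by simp, ?_⟩
    rw [show fderiv ℝ (fun γ : C(K, E) => (⟨V, hV.continuous⟩ : C(E, F)).comp γ) = _ from
      funext fun γ => (hd γ).fderiv]
    exact (pointwiseApplyCLM K E F).contDiff.comp
      (ih (hV.fderiv_right (m := ∞) (by simp)) (hc.fderiv ℝ))

/-- The Volterra operator `γ ↦ (s ↦ ∫₀ˢ γ)` on continuous functions on `[0, 1]`. -/
noncomputable def volterraCLM (E : Type*) [NormedAddCommGroup E] [NormedSpace ℝ E] :
    C(Icc (0 : ℝ) 1, E) →L[ℝ] C(Icc (0 : ℝ) 1, E) :=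
  LinearMap.mkContinuous
    { toFun := fun γ => ⟨fun s => ∫ τ in (0 : ℝ)..s, IccExtend zero_le_one γ τ, by
        have h : Continuous (IccExtend (zero_le_one' ℝ) γ) := γ.continuous.Icc_extend'
        exact (intervalIntegral.continuous_primitive
          (fun a b => h.intervalIntegrable a b) 0).comp continuous_subtype_val⟩
      map_add' := fun γ δ => by
        ext s
        have h : ∀ η : C(Icc (0 : ℝ) 1, E), Continuous (IccExtend (zero_le_one' ℝ) η) :=
          fun η => η.continuous.Icc_extend'
        exact intervalIntegral.integral_add ((h γ).intervalIntegrable _ _)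
          ((h δ).intervalIntegrable _ _)
      map_smul' := fun c γ => by
        ext s
        exact intervalIntegral.integral_smul _ _ } 1 (by
    intro γ
    rw [ContinuousMap.norm_le _ (by positivity)]
    intro s
    have := intervalIntegral.norm_integral_le_of_norm_le_const (a := 0) (b := (s : ℝ))
      (f := IccExtend (zero_le_one' ℝ) γ) (C := ‖γ‖) (fun τ _ => γ.norm_coe_le_norm _)
    refine this.trans ?_
    rw [one_mul, sub_zero, abs_of_nonneg s.2.1]
    exact mul_le_of_le_one_right (norm_nonneg _) s.2.2)

theorem volterraCLM_apply {E : Type*} [NormedAddCommGroup E] [NormedSpace ℝ E]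
    (γ : C(Icc (0 : ℝ) 1, E)) (s : Icc (0 : ℝ) 1) :
    volterraCLM E γ s = ∫ τ in (0 : ℝ)..s, IccExtend zero_le_one γ τ := rfl

theorem norm_volterraCLM_le (E : Type*) [NormedAddCommGroup E] [NormedSpace ℝ E] :
    ‖volterraCLM E‖ ≤ 1 :=
  LinearMap.mkContinuous_norm_le _ zero_le_one _

/-- The solutions of `γ(s) = x + ε ∫₀ˢ V(γ)` on `[0, 1]` are unique for small `ε`. -/
theorem volterra_solution_unique {E : Type*} [NormedAddCommGroup E] [NormedSpace ℝ E]
    {V : E → E} {L : NNReal} (hL : LipschitzWith L V) {ε : ℝ} (hε : |ε| * L < 1) {x : E}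
    {γ δ : C(Icc (0 : ℝ) 1, E)}
    (hγ : γ = ContinuousMap.const _ x + ε • volterraCLM E ((⟨V, hL.continuous⟩ : C(E, E)).comp γ))
    (hδ : δ = ContinuousMap.const _ x + ε • volterraCLM E ((⟨V, hL.continuous⟩ : C(E, E)).comp δ)) :
    γ = δ := by
  have h1 : γ - δ = ε • volterraCLM E ((⟨V, hL.continuous⟩ : C(E, E)).comp γ -
      (⟨V, hL.continuous⟩ : C(E, E)).comp δ) := by
    rw [map_sub, smul_sub]
    nth_rw 1 [hγ, hδ]
    abel
  have h2 : ‖(⟨V, hL.continuous⟩ : C(E, E)).comp γ - (⟨V, hL.continuous⟩ : C(E, E)).comp δ‖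
      ≤ L * ‖γ - δ‖ := by
    rw [ContinuousMap.norm_le _ (by positivity)]
    intro s
    have := hL.dist_le_mul (γ s) (δ s)
    rw [dist_eq_norm, dist_eq_norm] at this
    exact this.trans (by gcongr; exact (γ - δ).norm_coe_le_norm s)
  have h3 : ‖γ - δ‖ ≤ |ε| * L * ‖γ - δ‖ := by
    nth_rw 1 [h1]
    rw [norm_smul, Real.norm_eq_abs, mul_assoc]
    gcongr
    refine ((volterraCLM E).le_of_opNorm_le (norm_volterraCLM_le E) _).trans ?_
    rwa [one_mul]
  have h4 : ‖γ - δ‖ = 0 := by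
    by_contra hne
    have : 0 < ‖γ - δ‖ := lt_of_le_of_ne (norm_nonneg _) (Ne.symm hne)
    nlinarith
  exact sub_eq_zero.1 (norm_eq_zero.1 h4)

/-- Rescaling the time of a solution of `γ(s) = x + ε ∫₀ˢ V(γ)`. -/
theorem volterra_solution_rescale {E : Type*} [NormedAddCommGroup E] [NormedSpace ℝ E]
    {V : E → E} (hV : Continuous V) {ε : ℝ} {x : E} {γ : C(Icc (0 : ℝ) 1, E)}
    (hγ : γ = ContinuousMap.const _ x + ε • volterraCLM E ((⟨V, hV⟩ : C(E, E)).comp γ))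
    (τ : Icc (0 : ℝ) 1) :
    let δ : C(Icc (0 : ℝ) 1, E) := ⟨fun s => γ (τ * s), by fun_prop⟩
    δ = ContinuousMap.const _ x + (ε * τ) • volterraCLM E ((⟨V, hV⟩ : C(E, E)).comp δ) := by
  intro δ
  ext s
  have h1 : δ s = γ (τ * s) := rfl
  rw [h1, hγ]
  simp only [ContinuousMap.add_apply, ContinuousMap.const_apply, ContinuousMap.smul_apply,
    volterraCLM_apply]
  congr 1
  rw [mul_smul]
  congr 1
  have h2 := intervalIntegral.smul_integral_comp_mul_left (a := 0) (b := (s : ℝ))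
    (f := IccExtend (zero_le_one' ℝ) ((⟨V, hV⟩ : C(E, E)).comp γ)) (τ : ℝ)
  rw [mul_zero] at h2
  rw [show ((τ * s : Icc (0 : ℝ) 1) : ℝ) = (τ : ℝ) * s from rfl, ← h2]
  congr 1
  refine intervalIntegral.integral_congr fun σ hσ => ?_
  rw [uIcc_of_le s.2.1] at hσ
  have hσ' : σ ∈ Icc (0 : ℝ) 1 := ⟨hσ.1, hσ.2.trans s.2.2⟩
  rw [IccExtend_of_mem _ _ hσ']
  exact IccExtend_of_mem (zero_le_one' ℝ) _ (τ * ⟨σ, hσ'⟩ : Icc (0 : ℝ) 1).2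


/-- A compactly supported smooth vector field has a smooth local flow. -/
theorem exists_smooth_local_flow_of_hasCompactSupport {E : Type u} [NormedAddCommGroup E]
    [NormedSpace ℝ E] [CompleteSpace E] {V : E → E} (hV : ContDiff ℝ ∞ V)
    (hc : HasCompactSupport V) (x₀ : E) :
    ∃ θ : ℝ × E → E, ∃ r > 0, ContDiffOn ℝ ∞ θ (Ioo (-r) r ×ˢ Metric.ball x₀ r) ∧
      ∀ s ∈ Ioo (-r) r, ∀ x ∈ Metric.ball x₀ r, θ (0, x) = x ∧
        HasDerivAt (fun σ => θ (σ, x)) (V (θ (s, x))) s := by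
  obtain ⟨L, hL⟩ := hV.lipschitzWith_of_hasCompactSupport hc (by simp)
  let cst : E →L[ℝ] C(Icc (0 : ℝ) 1, E) := ContinuousLinearMap.const ℝ (Icc (0 : ℝ) 1)
  let G : C(Icc (0 : ℝ) 1, E) → C(Icc (0 : ℝ) 1, E) := fun γ =>
    volterraCLM E ((⟨V, hV.continuous⟩ : C(E, E)).comp γ)
  have hG : ContDiff ℝ ∞ G := (volterraCLM E).contDiff.comp
    (contDiff_infty.2 fun k => contDiff_postcomp k hV hc)
  -- The last component of P vanishes exactly when γ(s) = x + ε ∫₀ˢ V(γ), that is, when γ is the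
  -- integral curve from x run at speed ε. At ε = 0 the derivative of P is triangular with identity
  -- diagonal, so P is locally invertible.
  let P : (E × ℝ) × C(Icc (0 : ℝ) 1, E) → (E × ℝ) × C(Icc (0 : ℝ) 1, E) := fun z =>
    (z.1, z.2 - (cst z.1.1 + z.1.2 • G z.2))
  have hP : ContDiff ℝ ∞ P := by fun_prop
  let z₀ : (E × ℝ) × C(Icc (0 : ℝ) 1, E) := ((x₀, 0), cst x₀)
  let A : E × ℝ →L[ℝ] C(Icc (0 : ℝ) 1, E) := cst.comp (ContinuousLinearMap.fst ℝ E ℝ) +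
    (ContinuousLinearMap.snd ℝ E ℝ).smulRight (G (cst x₀))
  let P' : ((E × ℝ) × C(Icc (0 : ℝ) 1, E)) ≃L[ℝ] (E × ℝ) × C(Icc (0 : ℝ) 1, E) :=
    (ContinuousLinearEquiv.refl ℝ (E × ℝ)).skewProd
      (ContinuousLinearEquiv.refl ℝ C(Icc (0 : ℝ) 1, E)) (-A)
  have hP' : HasFDerivAt P
      (P' : ((E × ℝ) × C(Icc (0 : ℝ) 1, E)) →L[ℝ] (E × ℝ) × C(Icc (0 : ℝ) 1, E)) z₀ := by
    have hGd : HasFDerivAt G (fderiv ℝ G z₀.2) z₀.2 :=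
      (hG.differentiable (by simp) _).hasFDerivAt
    have h1 := (hasFDerivAt_fst (𝕜 := ℝ) (E := E × ℝ) (F := C(Icc (0 : ℝ) 1, E)) (p := z₀))
    have h2 := (hasFDerivAt_snd (𝕜 := ℝ) (E := E × ℝ) (F := C(Icc (0 : ℝ) 1, E)) (p := z₀))
    have h3 := h1.prodMk (h2.sub ((cst.hasFDerivAt.comp z₀ h1.fst).add
      (h1.snd.smul (hGd.comp z₀ h2))))
    refine h3.congr_fderiv ?_
    ext z <;> simp [P', A, z₀, sub_eq_add_neg]
  obtain ⟨e, he0, -, heP, hes⟩ := exists_openPartialHomeomorph_contDiffOn isOpen_univ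
    hP.contDiffOn (mem_univ z₀) P' hP'
  have hez0 : e z₀ = ((x₀, 0), 0) := by
    rw [heP]; simp [P, z₀]
  have htgt : {y : ℝ × E | ((y.2, y.1), (0 : C(Icc (0 : ℝ) 1, E))) ∈ e.target} ∈
      𝓝 ((0 : ℝ), x₀) := by
    have hcont : Continuous fun y : ℝ × E =>
        (((y.2, y.1), (0 : C(Icc (0 : ℝ) 1, E))) : (E × ℝ) × C(Icc (0 : ℝ) 1, E)) := by
      fun_prop
    refine (e.open_target.preimage hcont).mem_nhds ?_
    change ((x₀, (0 : ℝ)), (0 : C(Icc (0 : ℝ) 1, E))) ∈ e.target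
    rw [← hez0]
    exact e.map_source he0
  obtain ⟨r₀, hr₀, hr₀t⟩ := Metric.mem_nhds_iff.1 htgt
  let r := min r₀ (1 / (L + 1))
  have hr : 0 < r := lt_min hr₀ (by positivity)
  have hbox : ∀ s ∈ Ioo (-r) r, ∀ x ∈ Metric.ball x₀ r,
      ((x, s), (0 : C(Icc (0 : ℝ) 1, E))) ∈ e.target := by
    intro s hs x hx
    refine hr₀t (show (s, x) ∈ _ from ?_)
    rw [Metric.mem_ball, Prod.dist_eq, max_lt_iff]
    refine ⟨?_, (Metric.mem_ball.1 hx).trans_le (min_le_left _ _)⟩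
    rw [dist_zero_right, Real.norm_eq_abs]
    exact (abs_lt.2 hs).trans_le (min_le_left _ _)
  -- The bound r ≤ 1/(L+1) is chosen for this: it is the smallness needed for uniqueness of the
  -- integral equation.
  have hsmall : ∀ s ∈ Ioo (-r) r, |s| * L < 1 := by
    intro s hs
    have h1 : |s| < 1 / (L + 1) := (abs_lt.2 hs).trans_le (min_le_right _ _)
    have hL0 : (0 : ℝ) ≤ L := L.2
    rw [lt_div_iff₀ (by positivity)] at h1
    nlinarith [abs_nonneg s]
  let sol : ℝ × E → C(Icc (0 : ℝ) 1, E) := fun y => (e.symm ((y.2, y.1), 0)).2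
  have hsol : ∀ s ∈ Ioo (-r) r, ∀ x ∈ Metric.ball x₀ r,
      sol (s, x) = cst x + s • G (sol (s, x)) := by
    intro s hs x hx
    have h1 := e.right_inv (hbox s hs x hx)
    rw [heP] at h1
    have h2 : (e.symm ((x, s), 0)).1 = (x, s) := congrArg Prod.fst h1
    have h3 := congrArg Prod.snd h1
    simp only [P, h2] at h3
    exact sub_eq_zero.1 h3
  have hcst : ∀ x, cst x = ContinuousMap.const _ x := fun x => rfl
  -- By uniqueness, the curve of speed sτ at time 1 is the curve of speed s at time τ. So evaluation
  -- at time 1 defines the flow, with the speed as time variable.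
  have hresc : ∀ s ∈ Ioo (-r) r, ∀ x ∈ Metric.ball x₀ r, ∀ τ : Icc (0 : ℝ) 1,
      sol (s * τ, x) ⟨1, by simp⟩ = sol (s, x) τ := by
    intro s hs x hx τ
    have hsτ : s * τ ∈ Ioo (-r) r := by
      rw [mem_Ioo, ← abs_lt, abs_mul, abs_of_nonneg τ.2.1]
      exact (mul_le_of_le_one_right (abs_nonneg _) τ.2.2).trans_lt (abs_lt.2 hs)
    have h := volterra_solution_unique hL (hsmall _ hsτ) (hsol _ hsτ x hx)
      (volterra_solution_rescale hL.continuous (hsol s hs x hx) τ)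
    rw [h]
    change sol (s, x) (τ * 1) = _
    rw [mul_one]
  have hsm : ContDiffOn ℝ ∞ (fun y => sol y ⟨1, by simp⟩) (Ioo (-r) r ×ˢ Metric.ball x₀ r) := by
    have h1 : ContDiff ℝ ∞ fun y : ℝ × E =>
        (((y.2, y.1), (0 : C(Icc (0 : ℝ) 1, E))) : (E × ℝ) × C(Icc (0 : ℝ) 1, E)) := by
      fun_prop
    have h2 := hes.comp h1.contDiffOn (s := Ioo (-r) r ×ˢ Metric.ball x₀ r)
      (fun y hy => hbox _ hy.1 _ hy.2)
    exact (ContinuousMap.evalCLM ℝ (⟨1, by simp⟩ : Icc (0 : ℝ) 1)).contDiff.comp_contDiffOn h2.snd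
  refine ⟨fun y => sol y ⟨1, by simp⟩, r, hr, hsm, fun s hs x hx => ⟨?_, ?_⟩⟩
  · have h0 : (0 : ℝ) ∈ Ioo (-r) r := ⟨by linarith, hr⟩
    change sol (0, x) _ = x
    rw [hsol 0 h0 x hx, zero_smul, add_zero]
    rfl
  · have hd : DifferentiableAt ℝ (fun σ => sol (σ, x) ⟨1, by simp⟩) s := by
      have h1 : ContDiffAt ℝ ∞ (fun y => sol y ⟨1, by simp⟩) (s, x) :=
        hsm.contDiffAt ((isOpen_Ioo.prod Metric.isOpen_ball).mem_nhds ⟨hs, hx⟩)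
      exact (h1.differentiableAt (by simp)).comp (f := fun σ : ℝ => (σ, x)) s (by fun_prop)
    -- Writing s = ετ with ε ≠ 0 allows division by ε later; for s = 0 any nonzero ε serves, with τ
    -- = 0.
    obtain ⟨ε, hε, hε0, τ, hτ⟩ : ∃ ε ∈ Ioo (-r) r, ε ≠ 0 ∧ ∃ τ : Icc (0 : ℝ) 1, ε * τ = s := by
      by_cases h0 : s = 0
      · exact ⟨r / 2, ⟨by linarith, by linarith⟩, by positivity, ⟨0, by simp⟩, by simp [h0]⟩
      · exact ⟨s, hs, h0, ⟨1, by simp⟩, by simp⟩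
    have hγ := hsol ε hε x hx
    set γ := sol (ε, x) with hγd
    have hVγ : Continuous (IccExtend (zero_le_one' ℝ)
        ((⟨V, hV.continuous⟩ : C(E, E)).comp γ)) := ContinuousMap.continuous _ |>.Icc_extend'
    have hint : HasDerivAt (fun u => x + ε • ∫ t in (0 : ℝ)..u, IccExtend (zero_le_one' ℝ)
        ((⟨V, hV.continuous⟩ : C(E, E)).comp γ) t) (ε • V (γ τ)) τ := by
      have h1 := intervalIntegral.integral_hasDerivAt_right (hVγ.intervalIntegrable 0 τ)
        (hVγ.stronglyMeasurableAtFilter _ _) hVγ.continuousAt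
      rw [IccExtend_val] at h1
      exact (h1.const_smul ε).const_add x
    -- The integral formula holds only for u in [0, 1], so it yields a derivative within that
    -- interval. Two-sided differentiability is already known, and uniqueness of derivatives within
    -- [0, 1] identifies its value.
    have hleft : HasDerivWithinAt (fun u : ℝ => sol (ε * u, x) ⟨1, by simp⟩) (ε • V (γ τ))
        (Icc 0 1) τ := by
      refine hint.hasDerivWithinAt.congr (fun u hu => ?_) ?_
      · rw [hresc ε hε x hx ⟨u, hu⟩, ← hγd]; exact congrArg (· ⟨u, hu⟩) hγ
      · rw [hresc ε hε x hx τ, ← hγd]; exact congrArg (· τ) hγ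
    have hright : HasDerivAt (fun u : ℝ => sol (ε * u, x) ⟨1, by simp⟩)
        (ε • deriv (fun σ => sol (σ, x) ⟨1, by simp⟩) s) τ := by
      have h1 : HasDerivAt (fun u : ℝ => ε * u) ε τ := by
        simpa using (hasDerivAt_id (τ : ℝ)).const_mul ε
      have h2 := hd.hasDerivAt
      rw [← hτ] at h2 ⊢
      exact h2.scomp (τ : ℝ) h1
    have h3 := (uniqueDiffOn_Icc_zero_one τ τ.2).eq_deriv _ hleft hright.hasDerivWithinAt
    have h4 := smul_right_injective E hε0 h3
    have h5 : sol (s, x) ⟨1, by simp⟩ = γ τ := by rw [← hτ]; exact hresc ε hε x hx τ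
    change HasDerivAt _ (V (sol (s, x) ⟨1, by simp⟩)) s
    rw [h5, h4]
    exact hd.hasDerivAt

/-- A smooth vector field on an open subset of a finite dimensional space has a smooth local
flow. -/
theorem exists_smooth_local_flow {E : Type u} [NormedAddCommGroup E] [NormedSpace ℝ E]
    [FiniteDimensional ℝ E] {V : E → E} {U : Set E} (hU : IsOpen U) (hV : ContDiffOn ℝ ∞ V U)
    {x₀ : E} (hx₀ : x₀ ∈ U) :
    ∃ θ : ℝ × E → E, ∃ r > 0, ContDiffOn ℝ ∞ θ (Ioo (-r) r ×ˢ Metric.ball x₀ r) ∧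
      ∀ s ∈ Ioo (-r) r, ∀ x ∈ Metric.ball x₀ r, θ (0, x) = x ∧ θ (s, x) ∈ U ∧
        HasDerivAt (fun σ => θ (σ, x)) (V (θ (s, x))) s := by
  have : CompleteSpace E := FiniteDimensional.complete ℝ E
  obtain ⟨R, hR, hRU⟩ := Metric.nhds_basis_closedBall.mem_iff.1 (hU.mem_nhds hx₀)
  -- Multiplying by f extends V to a compactly supported smooth field unchanged within distance R/2
  -- of x₀; a smaller time and ball keep the flow in that region.
  let f : ContDiffBump x₀ := ⟨R / 2, R, by positivity, by linarith⟩
  have hfV : ContDiff ℝ ∞ fun x => f x • V x := by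
    rw [contDiff_iff_contDiffAt]
    intro x
    by_cases hx : x ∈ tsupport f
    · rw [f.tsupport_eq] at hx
      exact f.contDiff.contDiffAt.smul (hV.contDiffAt (hU.mem_nhds (hRU hx)))
    · refine (contDiffAt_const (c := (0 : E))).congr_of_eventuallyEq ?_
      filter_upwards [notMem_tsupport_iff_eventuallyEq.1 hx] with y hy
      simp [hy]
  obtain ⟨θ, r, hr, hsm, hθ⟩ := exists_smooth_local_flow_of_hasCompactSupport hfV
    (f.hasCompactSupport.smul_right) x₀
  have hopen : IsOpen (Ioo (-r) r ×ˢ Metric.ball x₀ r) := isOpen_Ioo.prod Metric.isOpen_ball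
  have h0 : ((0 : ℝ), x₀) ∈ Ioo (-r) r ×ˢ Metric.ball x₀ r :=
    ⟨⟨by linarith, hr⟩, Metric.mem_ball_self hr⟩
  have hθ0 : θ (0, x₀) = x₀ := (hθ 0 h0.1 x₀ h0.2).1
  have hnear : ∀ᶠ y in 𝓝 ((0 : ℝ), x₀), θ y ∈ Metric.ball x₀ (R / 2) := by
    refine (hsm.continuousOn.continuousAt (hopen.mem_nhds h0)).eventually_mem ?_
    rw [hθ0]
    exact Metric.ball_mem_nhds _ (by positivity)
  obtain ⟨r', hr', hr't⟩ := Metric.eventually_nhds_iff_ball.1 hnear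
  let ρ := min r r'
  have hρ : 0 < ρ := lt_min hr hr'
  have hI : Ioo (-ρ) ρ ⊆ Ioo (-r) r :=
    Ioo_subset_Ioo (neg_le_neg (min_le_left _ _)) (min_le_left _ _)
  have hB : Metric.ball x₀ ρ ⊆ Metric.ball x₀ r := Metric.ball_subset_ball (min_le_left _ _)
  refine ⟨θ, ρ, hρ, hsm.mono (prod_mono hI hB), fun s hs x hx => ?_⟩
  obtain ⟨h1, h2⟩ := hθ s (hI hs) x (hB hx)
  have h3 : θ (s, x) ∈ Metric.ball x₀ (R / 2) := by
    refine hr't (s, x) ?_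
    rw [Metric.mem_ball, Prod.dist_eq, max_lt_iff]
    refine ⟨?_, (Metric.mem_ball.1 hx).trans_le (min_le_right _ _)⟩
    rw [dist_zero_right, Real.norm_eq_abs]
    exact (abs_lt.2 hs).trans_le (min_le_right _ _)
  have h4 : f (θ (s, x)) = 1 := f.one_of_mem_closedBall (Metric.ball_subset_closedBall h3)
  rw [h4, one_smul] at h2
  exact ⟨h1, hRU (Metric.closedBall_subset_closedBall (by linarith)
    (Metric.ball_subset_closedBall h3)), h2⟩

end SmoothFlow

/-! ### Levi-Civita connection, curvature and their invariance under isometries -/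

section LocalGeometry

open Set Filter Topology

set_option maxSynthPendingDepth 3
set_option linter.unusedSectionVars false

variable {E : Type*} [NormedAddCommGroup E] [NormedSpace ℝ E]
  {E' : Type*} [NormedAddCommGroup E'] [NormedSpace ℝ E']

theorem two_le_infty : (2 : WithTop ℕ∞) ≤ ∞ :=
  WithTop.coe_le_coe.2 (le_top : (2 : ℕ∞) ≤ ⊤)

/-- A smooth Riemannian metric on the subset `U` of a normed space. -/
structure IsMetricOn (B : E → E →L[ℝ] E →L[ℝ] ℝ) (U : Set E) : Prop where
  contDiffOn : ContDiffOn ℝ ∞ B U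
  symm : ∀ x ∈ U, ∀ u v, B x u v = B x v u
  pos : ∀ x ∈ U, ∀ u, u ≠ 0 → 0 < B x u u

/-- The Christoffel symbols of the first kind,
`(u, v, w) ↦ ½ (∂ᵤ B(v, w) + ∂ᵥ B(u, w) - ∂_w B(u, v))`. -/
noncomputable def koszulForm (B : E → E →L[ℝ] E →L[ℝ] ℝ) (x : E) : E →L[ℝ] E →L[ℝ] E →L[ℝ] ℝ :=
  (1 / 2 : ℝ) • (fderiv ℝ B x + (fderiv ℝ B x).flip -
    ((ContinuousLinearMap.flipₗᵢ ℝ E E ℝ).toContinuousLinearEquiv :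
      (E →L[ℝ] E →L[ℝ] ℝ) →L[ℝ] (E →L[ℝ] E →L[ℝ] ℝ)).comp (fderiv ℝ B x).flip)

theorem koszulForm_apply (B : E → E →L[ℝ] E →L[ℝ] ℝ) (x u v w : E) :
    koszulForm B x u v w = (1 / 2 : ℝ) * (fderiv ℝ B x u v w + fderiv ℝ B x v u w
      - fderiv ℝ B x w u v) := by
  simp [koszulForm]

/-- The Christoffel symbols of the second kind of the metric `B`. -/
noncomputable def lcConn (B : E → E →L[ℝ] E →L[ℝ] ℝ) (x : E) : E →L[ℝ] E →L[ℝ] E :=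
  (ContinuousLinearMap.compL ℝ E (E →L[ℝ] ℝ) E (B x).inverse).comp (koszulForm B x)

/-- The map `u ↦ R(u, v) w` of the connection with Christoffel symbols `Γ`. -/
noncomputable def curvatureMap (Γ : E → E →L[ℝ] E →L[ℝ] E) (x v w : E) : E →L[ℝ] E :=
  ((fderiv ℝ Γ x).flip v).flip w - (fderiv ℝ Γ x v).flip w + (Γ x).flip (Γ x v w)
    - (Γ x v).comp ((Γ x).flip w)

theorem curvatureMap_apply (Γ : E → E →L[ℝ] E →L[ℝ] E) (x u v w : E) :
    curvatureMap Γ x v w u = fderiv ℝ Γ x u v w - fderiv ℝ Γ x v u w + Γ x u (Γ x v w)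
      - Γ x v (Γ x u w) := by
  simp [curvatureMap]

/-- The Ricci tensor of the connection with Christoffel symbols `Γ`. -/
noncomputable def ricciForm (Γ : E → E →L[ℝ] E →L[ℝ] E) (x v w : E) : ℝ :=
  LinearMap.trace ℝ E (curvatureMap Γ x v w : E →ₗ[ℝ] E)

/-- The covariant derivative `(∇_v b)(u)` of a 1-form. -/
noncomputable def covDerivForm (B : E → E →L[ℝ] E →L[ℝ] ℝ) (b : E → E →L[ℝ] ℝ) (x u v : E) : ℝ :=
  fderiv ℝ b x v u - b x (lcConn B x u v)

theorem fderiv_apply₂ {F G : Type*} [NormedAddCommGroup F] [NormedSpace ℝ F]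
    [NormedAddCommGroup G] [NormedSpace ℝ G] {A : E → E' →L[ℝ] F →L[ℝ] G} {x : E}
    (hA : DifferentiableAt ℝ A x) (u : E) (v : E') (w : F) :
    fderiv ℝ A x u v w = fderiv ℝ (fun y => A y v w) x u := by
  have h := ((hA.hasFDerivAt.clm_apply (hasFDerivAt_const v x)).clm_apply
    (hasFDerivAt_const w x)).fderiv
  rw [h]
  simp

namespace IsMetricOn

variable {B : E → E →L[ℝ] E →L[ℝ] ℝ} {U : Set E}

theorem mono (hB : IsMetricOn B U) {V : Set E} (h : V ⊆ U) : IsMetricOn B V :=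
  ⟨hB.contDiffOn.mono h, fun x hx => hB.symm x (h hx), fun x hx => hB.pos x (h hx)⟩

theorem eq_of_forall (hB : IsMetricOn B U) {x : E} (hx : x ∈ U) {u v : E}
    (h : ∀ w, B x u w = B x v w) : u = v := by
  by_contra hne
  have h1 := hB.pos x hx (u - v) (sub_ne_zero.2 hne)
  have h2 : B x (u - v) = 0 := by
    ext w
    simp [h w]
  simp [h2] at h1

theorem exists_equiv [FiniteDimensional ℝ E] (hB : IsMetricOn B U) {x : E} (hx : x ∈ U) :
    ∃ e : E ≃L[ℝ] (E →L[ℝ] ℝ), (e : E →L[ℝ] E →L[ℝ] ℝ) = B x := by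
  have hinj : Function.Injective (B x : E →ₗ[ℝ] E →L[ℝ] ℝ) := fun u v huv =>
    hB.eq_of_forall hx fun w => congrArg (fun f : E →L[ℝ] ℝ => f w) huv
  have hdim : Module.finrank ℝ E = Module.finrank ℝ (E →L[ℝ] ℝ) := by
    rw [← (LinearMap.toContinuousLinearMap (𝕜 := ℝ) (E := E) (F' := ℝ)).finrank_eq,
      ← Subspace.dual_finrank_eq]
  refine ⟨(LinearEquiv.ofInjectiveOfFinrankEq _ hinj hdim).toContinuousLinearEquiv, ?_⟩
  ext; rfl

/-- `ContinuousLinearMap.inverse` is 0 on maps that are not invertible; positivity and the equal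
dimensions of E and its dual exclude this case on U. -/
theorem inverse_apply [FiniteDimensional ℝ E] (hB : IsMetricOn B U) {x : E} (hx : x ∈ U)
    (l : E →L[ℝ] ℝ) : B x ((B x).inverse l) = l := by
  obtain ⟨e, he⟩ := hB.exists_equiv hx
  rw [← he, ContinuousLinearMap.inverse_equiv]
  exact e.apply_symm_apply l

theorem contDiffOn_inverse [FiniteDimensional ℝ E] (hB : IsMetricOn B U) :
    ContDiffOn ℝ ∞ (fun x => (B x).inverse) U := by
  have : CompleteSpace E := FiniteDimensional.complete ℝ E
  intro x hx
  obtain ⟨e, he⟩ := hB.exists_equiv hx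
  have h := contDiffAt_map_inverse (n := ∞) e
  rw [he] at h
  exact h.comp_contDiffWithinAt x (hB.contDiffOn x hx)

theorem lcConn_spec [FiniteDimensional ℝ E] (hB : IsMetricOn B U) {x : E} (hx : x ∈ U)
    (u v w : E) : B x (lcConn B x u v) w = koszulForm B x u v w := by
  simp only [lcConn, ContinuousLinearMap.comp_apply, ContinuousLinearMap.compL_apply]
  rw [hB.inverse_apply hx]

/-- Nondegeneracy makes the Koszul identity a characterization, so Christoffel symbols can be
guessed and checked without inverting the metric. -/
theorem lcConn_eq [FiniteDimensional ℝ E] (hB : IsMetricOn B U) {x : E} (hx : x ∈ U)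
    {u v z : E} (h : ∀ w, B x z w = koszulForm B x u v w) : lcConn B x u v = z :=
  hB.eq_of_forall hx fun w => by rw [hB.lcConn_spec hx, h]

theorem differentiableAt (hB : IsMetricOn B U) (hU : IsOpen U) {x : E} (hx : x ∈ U) :
    DifferentiableAt ℝ B x :=
  (hB.contDiffOn.contDiffAt (hU.mem_nhds hx)).differentiableAt (by simp)

theorem fderiv_symm (hB : IsMetricOn B U) (hU : IsOpen U) {x : E} (hx : x ∈ U) (u v w : E) :
    fderiv ℝ B x u v w = fderiv ℝ B x u w v := by
  rw [fderiv_apply₂ (hB.differentiableAt hU hx), fderiv_apply₂ (hB.differentiableAt hU hx)]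
  congr 1
  refine EventuallyEq.fderiv_eq ?_
  filter_upwards [hU.mem_nhds hx] with y hy using hB.symm y hy v w

theorem lcConn_symm [FiniteDimensional ℝ E] (hB : IsMetricOn B U) (hU : IsOpen U) {x : E}
    (hx : x ∈ U) (u v : E) : lcConn B x u v = lcConn B x v u := by
  refine hB.lcConn_eq hx fun w => ?_
  rw [hB.lcConn_spec hx, koszulForm_apply, koszulForm_apply, hB.fderiv_symm hU hx w]
  ring

theorem contDiffOn_lcConn [FiniteDimensional ℝ E] (hB : IsMetricOn B U) (hU : IsOpen U) :
    ContDiffOn ℝ ∞ (lcConn B) U := by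
  have hD : ContDiffOn ℝ ∞ (fderiv ℝ B) U := hB.contDiffOn.fderiv_of_isOpen hU (by simp)
  have hK : ContDiffOn ℝ ∞ (koszulForm B) U := by
    refine contDiffOn_clm_apply.2 fun u => contDiffOn_clm_apply.2 fun v =>
      contDiffOn_clm_apply.2 fun w => ?_
    simp only [koszulForm_apply]
    have h : ∀ a b c : E, ContDiffOn ℝ ∞ (fun x => fderiv ℝ B x a b c) U := fun a b c =>
      ((hD.clm_apply contDiffOn_const).clm_apply contDiffOn_const).clm_apply contDiffOn_const
    exact contDiffOn_const.mul (((h u v w).add (h v u w)).sub (h w u v))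
  exact ((ContinuousLinearMap.compL ℝ E (E →L[ℝ] ℝ) E).contDiff.comp_contDiffOn
    hB.contDiffOn_inverse).clm_comp hK

theorem differentiableAt_lcConn [FiniteDimensional ℝ E] (hB : IsMetricOn B U) (hU : IsOpen U)
    {x : E} (hx : x ∈ U) : DifferentiableAt ℝ (lcConn B) x :=
  ((hB.contDiffOn_lcConn hU).contDiffAt (hU.mem_nhds hx)).differentiableAt (by simp)

end IsMetricOn

/-- `φ` is a smooth map of `U` to `U'` which pulls the metric `B'` back to the metric `B`. -/
structure IsIsometryOn (B : E → E →L[ℝ] E →L[ℝ] ℝ) (U : Set E)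
    (B' : E' → E' →L[ℝ] E' →L[ℝ] ℝ) (U' : Set E') (φ : E → E') : Prop where
  isOpen : IsOpen U
  isOpen' : IsOpen U'
  metric : IsMetricOn B U
  metric' : IsMetricOn B' U'
  contDiffOn : ContDiffOn ℝ ∞ φ U
  mapsTo : MapsTo φ U U'
  pullback : ∀ x ∈ U, ∀ u v, B x u v = B' (φ x) (fderiv ℝ φ x u) (fderiv ℝ φ x v)

namespace IsIsometryOn

variable {B : E → E →L[ℝ] E →L[ℝ] ℝ} {U : Set E} {B' : E' → E' →L[ℝ] E' →L[ℝ] ℝ} {U' : Set E'}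
  {φ : E → E'} [FiniteDimensional ℝ E] [FiniteDimensional ℝ E']

/-- A vector killed by dφ would have length zero, so dφ is injective, hence bijective in equal
dimensions. -/
theorem exists_equiv (h : IsIsometryOn B U B' U' φ)
    (hdim : Module.finrank ℝ E = Module.finrank ℝ E') {x : E} (hx : x ∈ U) :
    ∃ e : E ≃L[ℝ] E', (e : E →L[ℝ] E') = fderiv ℝ φ x := by
  have hinj : Function.Injective (fderiv ℝ φ x : E →ₗ[ℝ] E') := by
    rw [← LinearMap.ker_eq_bot, LinearMap.ker_eq_bot']
    intro u hu
    by_contra hne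
    have h1 := h.metric.pos x hx u hne
    rw [h.pullback x hx, show fderiv ℝ φ x u = 0 from hu] at h1
    simp at h1
  refine ⟨(LinearEquiv.ofInjectiveOfFinrankEq _ hinj hdim).toContinuousLinearEquiv, ?_⟩
  ext; rfl

theorem contDiffOn_fderiv (h : IsIsometryOn B U B' U' φ) : ContDiffOn ℝ ∞ (fderiv ℝ φ) U :=
  h.contDiffOn.fderiv_of_isOpen h.isOpen (by simp)

theorem hasFDerivAt (h : IsIsometryOn B U B' U' φ) {x : E} (hx : x ∈ U) :
    HasFDerivAt φ (fderiv ℝ φ x) x :=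
  ((h.contDiffOn.contDiffAt (h.isOpen.mem_nhds hx)).differentiableAt (by simp)).hasFDerivAt

theorem hasFDerivAt_fderiv (h : IsIsometryOn B U B' U' φ) {x : E} (hx : x ∈ U) :
    HasFDerivAt (fderiv ℝ φ) (fderiv ℝ (fderiv ℝ φ) x) x :=
  ((h.contDiffOn_fderiv.contDiffAt (h.isOpen.mem_nhds hx)).differentiableAt
    (by simp)).hasFDerivAt

theorem fderiv_fderiv_symm (h : IsIsometryOn B U B' U' φ) {x : E} (hx : x ∈ U) (u v : E) :
    fderiv ℝ (fderiv ℝ φ) x u v = fderiv ℝ (fderiv ℝ φ) x v u :=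
  ((h.contDiffOn.contDiffAt (h.isOpen.mem_nhds hx)).isSymmSndFDerivAt
    (by simpa using two_le_infty)) u v

theorem fderiv_metric (h : IsIsometryOn B U B' U' φ) {x : E} (hx : x ∈ U) (u v w : E) :
    fderiv ℝ B x u v w =
      fderiv ℝ B' (φ x) (fderiv ℝ φ x u) (fderiv ℝ φ x v) (fderiv ℝ φ x w)
      + B' (φ x) (fderiv ℝ (fderiv ℝ φ) x u v) (fderiv ℝ φ x w)
      + B' (φ x) (fderiv ℝ φ x v) (fderiv ℝ (fderiv ℝ φ) x u w) := by
  rw [fderiv_apply₂ (h.metric.differentiableAt h.isOpen hx)]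
  have h1 : HasFDerivAt B' (fderiv ℝ B' (φ x)) (φ x) :=
    (h.metric'.differentiableAt h.isOpen' (h.mapsTo hx)).hasFDerivAt
  have h2 := h.hasFDerivAt_fderiv hx
  have h3 := ((h1.comp x (h.hasFDerivAt hx)).clm_apply (h2.clm_apply
    (hasFDerivAt_const v x))).clm_apply (h2.clm_apply (hasFDerivAt_const w x))
  have h4 : (fun y => B y v w) =ᶠ[𝓝 x]
      fun y => B' (φ y) (fderiv ℝ φ y v) (fderiv ℝ φ y w) := by
    filter_upwards [h.isOpen.mem_nhds hx] with y hy using h.pullback y hy v w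
  rw [h4.fderiv_eq]
  have h5 : fderiv ℝ (fun y => B' (φ y) (fderiv ℝ φ y v) (fderiv ℝ φ y w)) x = _ := h3.fderiv
  rw [h5]
  simp
  ring

/-- The transformation law of the Christoffel symbols. -/
theorem fderiv_lcConn (h : IsIsometryOn B U B' U' φ)
    (hdim : Module.finrank ℝ E = Module.finrank ℝ E') {x : E} (hx : x ∈ U) (u v : E) :
    fderiv ℝ φ x (lcConn B x u v) =
      lcConn B' (φ x) (fderiv ℝ φ x u) (fderiv ℝ φ x v) + fderiv ℝ (fderiv ℝ φ) x u v := by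
  obtain ⟨e, he⟩ := h.exists_equiv hdim hx
  refine h.metric'.eq_of_forall (h.mapsTo hx) fun w' => ?_
  obtain ⟨w, rfl⟩ : ∃ w, fderiv ℝ φ x w = w' :=
    ⟨e.symm w', by rw [← he]; exact e.apply_symm_apply w'⟩
  -- Of the six second-derivative terms in the Koszul combination, four cancel by symmetry of D²φ
  -- and two agree, leaving B'(D²φ(u, v), dφ w).
  rw [← h.pullback x hx, h.metric.lcConn_spec hx, map_add, add_apply,
    h.metric'.lcConn_spec (h.mapsTo hx), koszulForm_apply, koszulForm_apply, h.fderiv_metric hx,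
    h.fderiv_metric hx, h.fderiv_metric hx, h.fderiv_fderiv_symm hx v u,
    h.fderiv_fderiv_symm hx w u, h.fderiv_fderiv_symm hx w v,
    h.metric'.symm _ (h.mapsTo hx) (fderiv ℝ φ x v)]
  ring

/-- Differentiate the transformation law of the Christoffel symbols (`hD`) and antisymmetrize in u
and v: the third derivative of φ drops out by symmetry, and the remaining second-derivative terms
cancel against those coming from the quadratic part of the curvature. -/
theorem fderiv_curvatureMap (h : IsIsometryOn B U B' U' φ)
    (hdim : Module.finrank ℝ E = Module.finrank ℝ E') {x : E} (hx : x ∈ U) (u v w : E) :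
    fderiv ℝ φ x (curvatureMap (lcConn B) x v w u) =
      curvatureMap (lcConn B') (φ x) (fderiv ℝ φ x v) (fderiv ℝ φ x w) (fderiv ℝ φ x u) := by
  have hx' := h.mapsTo hx
  have hD : ∀ a b c : E, fderiv ℝ (fderiv ℝ φ) x a (lcConn B x b c)
      + fderiv ℝ φ x (fderiv ℝ (lcConn B) x a b c) =
      fderiv ℝ (lcConn B') (φ x) (fderiv ℝ φ x a) (fderiv ℝ φ x b) (fderiv ℝ φ x c)
      + lcConn B' (φ x) (fderiv ℝ (fderiv ℝ φ) x a b) (fderiv ℝ φ x c)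
      + lcConn B' (φ x) (fderiv ℝ φ x b) (fderiv ℝ (fderiv ℝ φ) x a c)
      + fderiv ℝ (fderiv ℝ (fderiv ℝ φ)) x a b c := by
    intro a b c
    have h1 := (h.metric'.differentiableAt_lcConn h.isOpen' hx').hasFDerivAt
    have h2 := h.hasFDerivAt_fderiv hx
    have h3 := ((h1.comp x (h.hasFDerivAt hx)).clm_apply (h2.clm_apply
      (hasFDerivAt_const b x))).clm_apply (h2.clm_apply (hasFDerivAt_const c x))
    have h4 : HasFDerivAt (fderiv ℝ (fderiv ℝ φ)) (fderiv ℝ (fderiv ℝ (fderiv ℝ φ)) x) x :=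
      (((h.contDiffOn_fderiv.fderiv_of_isOpen h.isOpen (m := ∞) (by simp)).contDiffAt
        (h.isOpen.mem_nhds hx)).differentiableAt (by simp)).hasFDerivAt
    have h5 := h3.add ((h4.clm_apply (hasFDerivAt_const b x)).clm_apply (hasFDerivAt_const c x))
    have h6 := (h.metric.differentiableAt_lcConn h.isOpen hx).hasFDerivAt
    have h7 := h2.clm_apply ((h6.clm_apply (hasFDerivAt_const b x)).clm_apply
      (hasFDerivAt_const c x))
    have h8 := h7.congr_of_eventuallyEq (f₁ := fun y =>
        lcConn B' (φ y) (fderiv ℝ φ y b) (fderiv ℝ φ y c) + fderiv ℝ (fderiv ℝ φ) y b c) (by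
      filter_upwards [h.isOpen.mem_nhds hx] with y hy using (h.fderiv_lcConn hdim hy b c).symm)
    have h9 := congrArg (fun l : E →L[ℝ] E' => l a) (h8.unique h5)
    simp only [add_apply, ContinuousLinearMap.flip_apply,
      ContinuousLinearMap.comp_apply, Function.comp_apply, zero_apply,
      map_zero, zero_add] at h9
    rw [add_comm, h9]
    abel
  have h1 := hD u v w
  have h2 := hD v u w
  have h3 : fderiv ℝ (fderiv ℝ (fderiv ℝ φ)) x u v = fderiv ℝ (fderiv ℝ (fderiv ℝ φ)) x v u :=
    ((h.contDiffOn_fderiv.contDiffAt (h.isOpen.mem_nhds hx)).isSymmSndFDerivAt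
    (by simpa using two_le_infty)) u v
  rw [h.fderiv_fderiv_symm hx v u, ← h3] at h2
  simp only [curvatureMap_apply, map_add, map_sub]
  rw [h.fderiv_lcConn hdim hx u, h.fderiv_lcConn hdim hx v (lcConn B x u w),
    h.fderiv_lcConn hdim hx v w, h.fderiv_lcConn hdim hx u w, map_add, map_add]
  linear_combination (norm := module) h1 - h2

/-- The Ricci tensor is a tensor. -/
theorem ricciForm_eq (h : IsIsometryOn B U B' U' φ)
    (hdim : Module.finrank ℝ E = Module.finrank ℝ E') {x : E} (hx : x ∈ U) (v w : E) :
    ricciForm (lcConn B) x v w =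
      ricciForm (lcConn B') (φ x) (fderiv ℝ φ x v) (fderiv ℝ φ x w) := by
  obtain ⟨e, he⟩ := h.exists_equiv hdim hx
  rw [ricciForm, ricciForm, ← LinearMap.trace_conj' _ e.toLinearEquiv]
  congr 1
  ext u'
  obtain ⟨u, rfl⟩ := e.surjective u'
  have h1 := h.fderiv_curvatureMap hdim hx u v w
  rw [← he] at h1
  simpa [LinearEquiv.conj_apply, ← he] using h1

/-- The covariant derivative of a 1-form is a tensor. -/
theorem covDerivForm_eq (h : IsIsometryOn B U B' U' φ)
    (hdim : Module.finrank ℝ E = Module.finrank ℝ E') {b : E → E →L[ℝ] ℝ} {b' : E' → E' →L[ℝ] ℝ}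
    (hb' : ∀ y ∈ U', DifferentiableAt ℝ b' y)
    (hbb' : ∀ x ∈ U, ∀ u, b x u = b' (φ x) (fderiv ℝ φ x u)) {x : E} (hx : x ∈ U) (u v : E) :
    covDerivForm B b x u v =
      covDerivForm B' b' (φ x) (fderiv ℝ φ x u) (fderiv ℝ φ x v) := by
  have h1 : HasFDerivAt b' (fderiv ℝ b' (φ x)) (φ x) := (hb' _ (h.mapsTo hx)).hasFDerivAt
  have h2 := ((h1.comp x (h.hasFDerivAt hx)).clm_comp (h.hasFDerivAt_fderiv hx))
  have h3 : b =ᶠ[𝓝 x] fun y => (b' (φ y)).comp (fderiv ℝ φ y) := by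
    filter_upwards [h.isOpen.mem_nhds hx] with y hy
    ext u
    exact hbb' y hy u
  have h4 : fderiv ℝ b x = _ := (h2.congr_of_eventuallyEq h3).fderiv
  rw [covDerivForm, covDerivForm, hbb' x hx, h.fderiv_lcConn hdim hx, h4]
  simp [h.fderiv_fderiv_symm hx v u]
  ring

end IsIsometryOn

end LocalGeometry

/-! ### Connection and Ricci tensor of dt² + (ct + d)² h -/

section WarpedProduct

open Set Filter Topology

set_option maxSynthPendingDepth 3
set_option linter.unusedSectionVars false

variable {F : Type*} [NormedAddCommGroup F] [NormedSpace ℝ F]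

/-- The warped product metric `dt² + (c t + d)² h` on `ℝ × F`. -/
noncomputable def warpedMetric (c d : ℝ) (h : F → F →L[ℝ] F →L[ℝ] ℝ) (z : ℝ × F) :
    ℝ × F →L[ℝ] ℝ × F →L[ℝ] ℝ :=
  (ContinuousLinearMap.mul ℝ ℝ).bilinearComp (ContinuousLinearMap.fst ℝ ℝ F)
      (ContinuousLinearMap.fst ℝ ℝ F) +
    (c * z.1 + d) ^ 2 • (h z.2).bilinearComp (ContinuousLinearMap.snd ℝ ℝ F)
      (ContinuousLinearMap.snd ℝ ℝ F)

theorem warpedMetric_apply (c d : ℝ) (h : F → F →L[ℝ] F →L[ℝ] ℝ) (z u v : ℝ × F) :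
    warpedMetric c d h z u v = u.1 * v.1 + (c * z.1 + d) ^ 2 * h z.2 u.2 v.2 := by
  simp [warpedMetric]

/-- The 1-form `(c t + d) dt` on `ℝ × F`. -/
noncomputable def warpedForm (c d : ℝ) (z : ℝ × F) : ℝ × F →L[ℝ] ℝ :=
  (c * z.1 + d) • ContinuousLinearMap.fst ℝ ℝ F

theorem warpedForm_apply (c d : ℝ) (z u : ℝ × F) : warpedForm c d z u = (c * z.1 + d) * u.1 := by
  simp [warpedForm]

theorem differentiableAt_warpedForm (c d : ℝ) (z : ℝ × F) :
    DifferentiableAt ℝ (warpedForm (F := F) c d) z := by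
  unfold warpedForm
  fun_prop

section

variable [FiniteDimensional ℝ F] {c d : ℝ} {h : F → F →L[ℝ] F →L[ℝ] ℝ} {I : Set ℝ} {V : Set F}

theorem contDiffOn_warpedMetric (hh : IsMetricOn h V) :
    ContDiffOn ℝ ∞ (warpedMetric c d h) (univ ×ˢ V) := by
  refine contDiffOn_clm_apply.2 fun u => contDiffOn_clm_apply.2 fun v => ?_
  simp only [warpedMetric_apply]
  have h1 : ContDiffOn ℝ ∞ (fun z : ℝ × F => h z.2 u.2 v.2) (univ ×ˢ V) :=
    ((hh.contDiffOn.comp contDiffOn_snd fun z hz => hz.2).clm_apply contDiffOn_const).clm_apply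
      contDiffOn_const
  exact contDiffOn_const.add (ContDiffOn.mul (by fun_prop) h1)

theorem isMetricOn_warpedMetric (hh : IsMetricOn h V) (hI : ∀ t ∈ I, c * t + d ≠ 0) :
    IsMetricOn (warpedMetric c d h) (I ×ˢ V) where
  contDiffOn := (contDiffOn_warpedMetric hh).mono (prod_mono (subset_univ _) subset_rfl)
  symm := fun z hz u v => by
    rw [warpedMetric_apply, warpedMetric_apply, hh.symm _ hz.2, mul_comm u.1]
  pos := fun z hz u hu => by
    rw [warpedMetric_apply]
    have hf : 0 < (c * z.1 + d) ^ 2 := by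
      have := hI _ hz.1
      positivity
    by_cases h2 : u.2 = 0
    · have h1 : u.1 ≠ 0 := fun h1 => hu (Prod.ext h1 h2)
      rw [h2]
      simp only [map_zero, mul_zero, add_zero]
      exact mul_self_pos.2 h1
    · have := hh.pos _ hz.2 _ h2
      have := mul_self_nonneg u.1
      positivity

theorem fderiv_warpedMetric (hh : IsMetricOn h V) (hV : IsOpen V) {z : ℝ × F} (hz : z.2 ∈ V)
    (u v w : ℝ × F) :
    fderiv ℝ (warpedMetric c d h) z u v w =
      2 * c * (c * z.1 + d) * u.1 * h z.2 v.2 w.2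
        + (c * z.1 + d) ^ 2 * fderiv ℝ h z.2 u.2 v.2 w.2 := by
  have hd := hh.differentiableAt hV hz
  have hdw : DifferentiableAt ℝ (warpedMetric c d h) z :=
    ((contDiffOn_warpedMetric hh).contDiffAt
      ((isOpen_univ.prod hV).mem_nhds ⟨mem_univ _, hz⟩)).differentiableAt (by simp)
  rw [fderiv_apply₂ hdw]
  simp only [warpedMetric_apply]
  have h1 : HasFDerivAt (fun z : ℝ × F => c * z.1 + d) (c • ContinuousLinearMap.fst ℝ ℝ F) z :=
    (hasFDerivAt_fst.const_mul c).add_const d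
  have h2 : HasFDerivAt (fun z : ℝ × F => h z.2) _ z := hd.hasFDerivAt.comp z hasFDerivAt_snd
  have h3 := ((h1.pow 2).mul ((h2.clm_apply (hasFDerivAt_const v.2 z)).clm_apply
    (hasFDerivAt_const w.2 z))).const_add (v.1 * w.1)
  refine (congrArg (fun l : ℝ × F →L[ℝ] ℝ => l u) h3.fderiv).trans ?_
  simp
  ring

/-- With f = ct + d and f' = c these are the classical Γ(∂ₜ, v) = (f'/f) v and Γ(v, w)ᵗ = −f f' h(v,
w), verified through the Koszul identity. -/
theorem lcConn_warpedMetric (hh : IsMetricOn h V) (hV : IsOpen V) (hI : ∀ t ∈ I, c * t + d ≠ 0)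
    {z : ℝ × F} (hz : z ∈ I ×ˢ V) (u v : ℝ × F) :
    lcConn (warpedMetric c d h) z u v =
      (-(c * (c * z.1 + d) * h z.2 u.2 v.2),
        (c * (c * z.1 + d)⁻¹) • (u.1 • v.2 + v.1 • u.2) + lcConn h z.2 u.2 v.2) := by
  have hf := hI _ hz.1
  refine (isMetricOn_warpedMetric hh hI).lcConn_eq hz fun w => ?_
  rw [koszulForm_apply, fderiv_warpedMetric hh hV hz.2, fderiv_warpedMetric hh hV hz.2,
    fderiv_warpedMetric hh hV hz.2, warpedMetric_apply]
  simp only [map_add, map_smul, add_apply, smul_apply, smul_eq_mul,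
    hh.lcConn_spec hz.2, koszulForm_apply]
  field_simp
  ring

theorem fderiv_lcConn_warpedMetric (hh : IsMetricOn h V) (hV : IsOpen V) (hIo : IsOpen I)
    (hI : ∀ t ∈ I, c * t + d ≠ 0) {z : ℝ × F} (hz : z ∈ I ×ˢ V) (u v w : ℝ × F) :
    fderiv ℝ (lcConn (warpedMetric c d h)) z u v w =
      (-(c * (c * u.1 * h z.2 v.2 w.2 + (c * z.1 + d) * fderiv ℝ h z.2 u.2 v.2 w.2)),
        (-(c ^ 2 * u.1 * ((c * z.1 + d) ^ 2)⁻¹)) • (v.1 • w.2 + w.1 • v.2)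
          + fderiv ℝ (lcConn h) z.2 u.2 v.2 w.2) := by
  have hf := hI _ hz.1
  have hopen : IsOpen (I ×ˢ V) := hIo.prod hV
  rw [fderiv_apply₂ ((isMetricOn_warpedMetric hh hI).differentiableAt_lcConn hopen hz)]
  have h0 : (fun z => lcConn (warpedMetric c d h) z v w) =ᶠ[𝓝 z] fun z =>
      (-(c * (c * z.1 + d) * h z.2 v.2 w.2),
        (c * (c * z.1 + d)⁻¹) • (v.1 • w.2 + w.1 • v.2) + lcConn h z.2 v.2 w.2) := by
    filter_upwards [hopen.mem_nhds hz] with y hy using lcConn_warpedMetric hh hV hI hy v w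
  have h1 : HasFDerivAt (fun z : ℝ × F => c * z.1 + d) (c • ContinuousLinearMap.fst ℝ ℝ F) z :=
    (hasFDerivAt_fst.const_mul c).add_const d
  have h2 : HasFDerivAt (fun z : ℝ × F => h z.2) _ z :=
    (hh.differentiableAt hV hz.2).hasFDerivAt.comp z hasFDerivAt_snd
  have h3 : HasFDerivAt (fun z : ℝ × F => lcConn h z.2) _ z :=
    (hh.differentiableAt_lcConn hV hz.2).hasFDerivAt.comp z hasFDerivAt_snd
  have h4 := ((h1.const_mul c).mul ((h2.clm_apply (hasFDerivAt_const v.2 z)).clm_apply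
    (hasFDerivAt_const w.2 z))).neg
  have h5 : HasFDerivAt (fun z : ℝ × F => (c * z.1 + d)⁻¹) _ z :=
    (hasDerivAt_inv hf).comp_hasFDerivAt z h1
  have h6 := ((h5.const_mul c).smul_const (v.1 • w.2 + w.1 • v.2)).add
    ((h3.clm_apply (hasFDerivAt_const v.2 z)).clm_apply (hasFDerivAt_const w.2 z))
  have h7 := h4.prodMk h6
  rw [h0.fderiv_eq]
  refine (congrArg (fun l : ℝ × F →L[ℝ] ℝ × F => l u) h7.fderiv).trans ?_
  ext
  · simp
    ring
  · simp
    module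

/-- Split L into its ℝ-valued and F-valued parts; cyclicity of the trace leaves only the two
diagonal blocks. -/
theorem trace_eq_fst_add_trace_snd (L : ℝ × F →ₗ[ℝ] ℝ × F) :
    LinearMap.trace ℝ (ℝ × F) L = (L (1, 0)).1 +
      LinearMap.trace ℝ F (LinearMap.snd ℝ ℝ F ∘ₗ L ∘ₗ LinearMap.inr ℝ ℝ F) := by
  have h1 : L = LinearMap.inl ℝ ℝ F ∘ₗ (LinearMap.fst ℝ ℝ F ∘ₗ L) +
      LinearMap.inr ℝ ℝ F ∘ₗ (LinearMap.snd ℝ ℝ F ∘ₗ L) := by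
    apply LinearMap.ext
    intro z
    ext <;> simp
  nth_rw 1 [h1]
  rw [map_add, LinearMap.trace_comp_comm', LinearMap.trace_comp_comm' (LinearMap.snd ℝ ℝ F ∘ₗ L)]
  congr 1
  rw [LinearMap.trace_eq_matrix_trace ℝ (Module.Basis.singleton Unit ℝ)]
  simp [Matrix.trace, LinearMap.toMatrix_apply]

/-- The Ricci tensor of a warped product `dt² + (c t + d)² h`. -/
theorem ricciForm_warpedMetric (hh : IsMetricOn h V) (hV : IsOpen V) (hIo : IsOpen I)
    (hI : ∀ t ∈ I, c * t + d ≠ 0) {z : ℝ × F} (hz : z ∈ I ×ˢ V) (v w : ℝ × F) :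
    ricciForm (lcConn (warpedMetric c d h)) z v w =
      ricciForm (lcConn h) z.2 v.2 w.2
        - ((Module.finrank ℝ F : ℝ) - 1) * c ^ 2 * h z.2 v.2 w.2 := by
  have hf := hI _ hz.1
  -- In slice components this block is u ↦ R_h(u, v)w + c²(h(w, u) v − h(v, w) u). With m = dim F
  -- its trace is Ric_h(v, w) + c² h(v, w) − m c² h(v, w).
  have h1 : (LinearMap.snd ℝ ℝ F ∘ₗ (curvatureMap (lcConn (warpedMetric c d h)) z v w :
        ℝ × F →ₗ[ℝ] ℝ × F) ∘ₗ LinearMap.inr ℝ ℝ F) =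
      (curvatureMap (lcConn h) z.2 v.2 w.2 : F →ₗ[ℝ] F)
        + c ^ 2 • ((h z.2 w.2 : F →ₗ[ℝ] ℝ).smulRight v.2)
        - (c ^ 2 * h z.2 v.2 w.2) • LinearMap.id := by
    apply LinearMap.ext
    intro u
    simp only [LinearMap.comp_apply, LinearMap.inr_apply, ContinuousLinearMap.coe_coe,
      curvatureMap_apply, fderiv_lcConn_warpedMetric hh hV hIo hI hz,
      lcConn_warpedMetric hh hV hI hz, LinearMap.snd_apply, LinearMap.add_apply,
      LinearMap.sub_apply, LinearMap.smul_apply, LinearMap.smulRight_apply, LinearMap.id_apply,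
      Prod.snd_add, Prod.snd_sub, map_add, map_smul]
    rw [hh.symm _ hz.2 w.2 u, hh.lcConn_symm hV hz.2 v.2 u]
    simp only [zero_smul, zero_add, add_zero, mul_zero, smul_add]
    match_scalars <;> field_simp <;> ring
  -- The radial entry carries the factor f'', which vanishes for affine f.
  have h2 : ((curvatureMap (lcConn (warpedMetric c d h)) z v w) (1, 0)).1 = 0 := by
    simp only [curvatureMap_apply, fderiv_lcConn_warpedMetric hh hV hIo hI hz,
      lcConn_warpedMetric hh hV hI hz]
    simp
    field_simp
    ring
  rw [ricciForm, trace_eq_fst_add_trace_snd, h1, ContinuousLinearMap.coe_coe, h2, zero_add,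
    map_sub, map_add, map_smul, map_smul, LinearMap.trace_smulRight, LinearMap.trace_id, ricciForm]
  simp only [ContinuousLinearMap.coe_coe, smul_eq_mul, hh.symm _ hz.2 w.2]
  ring

/-- `∇((c t + d) dt) = c g` for the warped product `g = dt² + (c t + d)² h`. -/
theorem covDerivForm_warpedForm (hh : IsMetricOn h V) (hV : IsOpen V)
    (hI : ∀ t ∈ I, c * t + d ≠ 0) {z : ℝ × F} (hz : z ∈ I ×ˢ V) (u v : ℝ × F) :
    covDerivForm (warpedMetric c d h) (warpedForm c d) z u v = c * warpedMetric c d h z u v := by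
  have hf := hI _ hz.1
  have h1 : HasFDerivAt (fun z : ℝ × F => c * z.1 + d) (c • ContinuousLinearMap.fst ℝ ℝ F) z :=
    (hasFDerivAt_fst.const_mul c).add_const d
  have h2 : fderiv ℝ (warpedForm (F := F) c d) z = _ :=
    (h1.smul_const (ContinuousLinearMap.fst ℝ ℝ F)).fderiv
  rw [covDerivForm, h2, warpedForm_apply, lcConn_warpedMetric hh hV hI hz, warpedMetric_apply]
  simp
  ring

end

end WarpedProduct

/-! ### From index formulas to coordinate-free forms -/

section Components

open Set Filter Topology

set_option maxSynthPendingDepth 3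

variable {n : ℕ} {B : EuclideanSpace ℝ (Fin n) → EuclideanSpace ℝ (Fin n) →L[ℝ]
    EuclideanSpace ℝ (Fin n) →L[ℝ] ℝ} {U : Set (EuclideanSpace ℝ (Fin n))}
  {G : EuclideanSpace ℝ (Fin n) → Matrix (Fin n) (Fin n) ℝ}

theorem sum_smul_single (v : EuclideanSpace ℝ (Fin n)) :
    ∑ i, v i • EuclideanSpace.single i (1 : ℝ) = v := by
  have := (EuclideanSpace.basisFun (Fin n) ℝ).sum_repr v
  simpa using this

theorem clm_apply_eq_sum {W : Type*} [NormedAddCommGroup W] [NormedSpace ℝ W]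
    (l : EuclideanSpace ℝ (Fin n) →L[ℝ] W) (v : EuclideanSpace ℝ (Fin n)) :
    l v = ∑ i, v i • l (EuclideanSpace.single i (1 : ℝ)) := by
  conv_lhs => rw [← sum_smul_single v]
  simp

/-- The functional `l` covers both uses: the identity for components of the metric, a coordinate for
Christoffel symbols. -/
theorem partialD_apply₂ {W : Type*} [NormedAddCommGroup W] [NormedSpace ℝ W]
    {A : EuclideanSpace ℝ (Fin n) → EuclideanSpace ℝ (Fin n) →L[ℝ]
      EuclideanSpace ℝ (Fin n) →L[ℝ] W} (hU : IsOpen U) {x : EuclideanSpace ℝ (Fin n)}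
    (hx : x ∈ U) (hA : DifferentiableAt ℝ A x) (l : W →L[ℝ] ℝ)
    {f : EuclideanSpace ℝ (Fin n) → ℝ} (v w : EuclideanSpace ℝ (Fin n))
    (hf : ∀ y ∈ U, f y = l (A y v w)) (i : Fin n) :
    partialD i f x = l (fderiv ℝ A x (EuclideanSpace.single i 1) v w) := by
  have h1 : f =ᶠ[𝓝 x] fun y => l (A y v w) := by
    filter_upwards [hU.mem_nhds hx] with y hy using hf y hy
  have h2 := l.hasFDerivAt.comp x ((hA.hasFDerivAt.clm_apply (hasFDerivAt_const v x)).clm_apply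
    (hasFDerivAt_const w x))
  rw [partialD, (h2.congr_of_eventuallyEq h1).fderiv]
  simp

/-- Both sides solve the linear system with matrix G and the Koszul form as right-hand side;
positivity of the metric makes the matrix invertible. -/
theorem christoffel_eq_lcConn (hB : IsMetricOn B U) (hU : IsOpen U)
    (hG : ∀ x ∈ U, ∀ i j, G x i j = B x (EuclideanSpace.single i 1) (EuclideanSpace.single j 1))
    {x : EuclideanSpace ℝ (Fin n)} (hx : x ∈ U) (k i j : Fin n) :
    christoffel G k i j x =
      lcConn B x (EuclideanSpace.single i 1) (EuclideanSpace.single j 1) k := by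
  set Γ := lcConn B x (EuclideanSpace.single i 1) (EuclideanSpace.single j 1) with hΓ
  have hpd : ∀ a b c, partialD a (fun y => G y b c) x = fderiv ℝ B x (EuclideanSpace.single a 1)
      (EuclideanSpace.single b 1) (EuclideanSpace.single c 1) := fun a b c =>
    partialD_apply₂ hU hx (hB.differentiableAt hU hx) (ContinuousLinearMap.id ℝ ℝ) _ _
      (fun y hy => hG y hy b c) a
  have hdet : (G x).det ≠ 0 := by
    intro h0
    obtain ⟨v, hv, hGv⟩ := Matrix.exists_mulVec_eq_zero_iff.2 h0
    have hv' : WithLp.toLp 2 v ≠ 0 := by simpa using hv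
    have hpos := hB.pos x hx _ hv'
    have hz : B x (WithLp.toLp 2 v) (WithLp.toLp 2 v) = 0 := by
      rw [clm_apply_eq_sum (B x), sum_apply]
      refine Finset.sum_eq_zero fun a _ => ?_
      rw [smul_apply, clm_apply_eq_sum (B x _)]
      have := congrFun hGv a
      simp only [Matrix.mulVec, dotProduct, Pi.zero_apply, hG x hx] at this
      simp only [smul_eq_mul, mul_comm (v _)]
      rw [this, zero_mul]
    exact hpos.ne' hz
  have hmul : ∀ l, (G x).mulVec Γ l = koszulForm B x (EuclideanSpace.single i 1)
      (EuclideanSpace.single j 1) (EuclideanSpace.single l 1) := by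
    intro l
    rw [← hB.lcConn_spec hx, ← hΓ, clm_apply_eq_sum (B x) Γ, sum_apply]
    simp only [Matrix.mulVec, dotProduct]
    refine Finset.sum_congr rfl fun m _ => ?_
    rw [hG x hx, hB.symm x hx, smul_apply, smul_eq_mul, mul_comm]
  have hinv : (G x)⁻¹.mulVec ((G x).mulVec Γ) = Γ := by
    rw [Matrix.mulVec_mulVec, Matrix.nonsing_inv_mul _ (isUnit_iff_ne_zero.2 hdet),
      Matrix.one_mulVec]
  rw [← congrFun hinv k, christoffel, Matrix.mulVec, dotProduct, Finset.mul_sum]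
  refine Finset.sum_congr rfl fun l _ => ?_
  rw [hmul, koszulForm_apply, hpd, hpd, hpd]
  ring

/-- The lower indices appear in the order in which `curvatureMap` uses them; torsion-freeness
permits the exchange. -/
theorem partialD_christoffel (hB : IsMetricOn B U) (hU : IsOpen U)
    (hG : ∀ x ∈ U, ∀ i j, G x i j = B x (EuclideanSpace.single i 1) (EuclideanSpace.single j 1))
    {x : EuclideanSpace ℝ (Fin n)} (hx : x ∈ U) (k l i j : Fin n) :
    partialD k (christoffel G l i j) x =
      fderiv ℝ (lcConn B) x (EuclideanSpace.single k 1) (EuclideanSpace.single j 1)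
        (EuclideanSpace.single i 1) l :=
  partialD_apply₂ hU hx (hB.differentiableAt_lcConn hU hx) (EuclideanSpace.proj l) _ _
    (fun y hy => by
      rw [christoffel_eq_lcConn hB hU hG hy, hB.lcConn_symm hU hy]; rfl) k

/-- The components of the Ricci tensor are given by the Ricci form. -/
theorem ricciComp_eq_ricciForm (hB : IsMetricOn B U) (hU : IsOpen U)
    (hG : ∀ x ∈ U, ∀ i j, G x i j = B x (EuclideanSpace.single i 1) (EuclideanSpace.single j 1))
    {x : EuclideanSpace ℝ (Fin n)} (hx : x ∈ U) (i j : Fin n) :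
    ricciComp G i j x = ricciForm (lcConn B) x (EuclideanSpace.single j 1)
      (EuclideanSpace.single i 1) := by
  rw [ricciForm, LinearMap.trace_eq_matrix_trace ℝ (EuclideanSpace.basisFun (Fin n) ℝ).toBasis,
    Matrix.trace, ricciComp, ← Finset.sum_add_distrib]
  refine Finset.sum_congr rfl fun k _ => ?_
  have hdiag : (LinearMap.toMatrix (EuclideanSpace.basisFun (Fin n) ℝ).toBasis
      (EuclideanSpace.basisFun (Fin n) ℝ).toBasis (curvatureMap (lcConn B) x
      (EuclideanSpace.single j 1) (EuclideanSpace.single i 1) :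
        EuclideanSpace ℝ (Fin n) →ₗ[ℝ] EuclideanSpace ℝ (Fin n))).diag k =
      curvatureMap (lcConn B) x (EuclideanSpace.single j 1) (EuclideanSpace.single i 1)
        (EuclideanSpace.single k 1) k := by
    simp [Matrix.diag, LinearMap.toMatrix_apply]
  have hexp : ∀ u v : EuclideanSpace ℝ (Fin n), lcConn B x u v k =
      ∑ l, v l * lcConn B x u (EuclideanSpace.single l 1) k := by
    intro u v
    rw [clm_apply_eq_sum (lcConn B x u) v]
    simp
  rw [hdiag, curvatureMap_apply]
  simp only [PiLp.sub_apply, PiLp.add_apply]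
  rw [hexp _ (lcConn B x (EuclideanSpace.single j 1) _),
    hexp _ (lcConn B x (EuclideanSpace.single k 1) _), partialD_christoffel hB hU hG hx,
    partialD_christoffel hB hU hG hx, add_sub_assoc, ← Finset.sum_sub_distrib]
  congr 1
  refine Finset.sum_congr rfl fun l _ => ?_
  rw [christoffel_eq_lcConn hB hU hG hx, christoffel_eq_lcConn hB hU hG hx,
    christoffel_eq_lcConn hB hU hG hx, christoffel_eq_lcConn hB hU hG hx,
    hB.lcConn_symm hU hx (EuclideanSpace.single i 1),
    hB.lcConn_symm hU hx (EuclideanSpace.single i 1)]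
  ring

/-- The components of the covariant derivative are given by the covariant derivative form. -/
theorem covDerivComp_eq_covDerivForm (hB : IsMetricOn B U) (hU : IsOpen U)
    (hG : ∀ x ∈ U, ∀ i j, G x i j = B x (EuclideanSpace.single i 1) (EuclideanSpace.single j 1))
    {b : Fin n → EuclideanSpace ℝ (Fin n) → ℝ}
    {β : EuclideanSpace ℝ (Fin n) → EuclideanSpace ℝ (Fin n) →L[ℝ] ℝ}
    (hb : ∀ x ∈ U, ∀ i, b i x = β x (EuclideanSpace.single i 1))
    {x : EuclideanSpace ℝ (Fin n)} (hx : x ∈ U) (hβ : DifferentiableAt ℝ β x) (i j : Fin n) :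
    covDerivComp G b i j x = covDerivForm B β x (EuclideanSpace.single i 1)
      (EuclideanSpace.single j 1) := by
  have h1 : b i =ᶠ[𝓝 x] fun y => β y (EuclideanSpace.single i 1) := by
    filter_upwards [hU.mem_nhds hx] with y hy using hb y hy i
  have h2 := hβ.hasFDerivAt.clm_apply (hasFDerivAt_const (EuclideanSpace.single i (1 : ℝ)) x)
  rw [covDerivComp, covDerivForm, partialD, (h2.congr_of_eventuallyEq h1).fderiv,
    clm_apply_eq_sum (β x) (lcConn B x _ _)]
  simp [christoffel_eq_lcConn hB hU hG hx, hb x hx]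

theorem bilin_eq_of_single {P Q : EuclideanSpace ℝ (Fin n) →ₗ[ℝ] EuclideanSpace ℝ (Fin n) →ₗ[ℝ] ℝ}
    (h : ∀ i j, P (EuclideanSpace.single i 1) (EuclideanSpace.single j 1) =
      Q (EuclideanSpace.single i 1) (EuclideanSpace.single j 1)) : P = Q :=
  LinearMap.ext_basis (EuclideanSpace.basisFun (Fin n) ℝ).toBasis
    (EuclideanSpace.basisFun (Fin n) ℝ).toBasis (by simpa using h)

/-- Both tensors are bilinear, so agreement on the standard basis is enough. The reversed index
order from `ricciComp_eq_ricciForm` is harmless because the metric is symmetric. -/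
theorem forall_ricciComp_iff (hB : IsMetricOn B U) (hU : IsOpen U)
    (hG : ∀ x ∈ U, ∀ i j, G x i j = B x (EuclideanSpace.single i 1) (EuclideanSpace.single j 1))
    {x : EuclideanSpace ℝ (Fin n)} (hx : x ∈ U) (κ : ℝ) :
    (∀ i j, ricciComp G i j x = κ * G x i j) ↔
      ∀ v w, ricciForm (lcConn B) x v w = κ * B x v w := by
  refine ⟨fun h => ?_, fun h i j => ?_⟩
  · let P : EuclideanSpace ℝ (Fin n) →ₗ[ℝ] EuclideanSpace ℝ (Fin n) →ₗ[ℝ] ℝ :=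
      LinearMap.mk₂ ℝ (ricciForm (lcConn B) x)
        (fun v₁ v₂ w => by
          rw [ricciForm, ricciForm, ricciForm, ← map_add]
          congr 1; ext u : 1; simp [curvatureMap_apply]; abel)
        (fun a v w => by
          rw [ricciForm, ricciForm, ← map_smul]
          congr 1; ext u : 1; simp [curvatureMap_apply]; module)
        (fun v w₁ w₂ => by
          rw [ricciForm, ricciForm, ricciForm, ← map_add]
          congr 1; ext u : 1; simp [curvatureMap_apply]; abel)
        (fun a v w => by
          rw [ricciForm, ricciForm, ← map_smul]
          congr 1; ext u : 1; simp [curvatureMap_apply]; module)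
    let Q : EuclideanSpace ℝ (Fin n) →ₗ[ℝ] EuclideanSpace ℝ (Fin n) →ₗ[ℝ] ℝ :=
      LinearMap.mk₂ ℝ (fun v w => κ * B x v w) (by intros; simp; ring) (by intros; simp; ring)
        (by intros; simp; ring) (by intros; simp; ring)
    have hPQ : P = Q := bilin_eq_of_single fun j i => by
      have h1 := h i j
      rw [ricciComp_eq_ricciForm hB hU hG hx, hG x hx, hB.symm x hx] at h1
      exact h1
    intro v w
    exact congrArg (fun R : EuclideanSpace ℝ (Fin n) →ₗ[ℝ] EuclideanSpace ℝ (Fin n) →ₗ[ℝ] ℝ =>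
      R v w) hPQ
  · rw [ricciComp_eq_ricciForm hB hU hG hx, h, hG x hx, hB.symm x hx]

theorem forall_covDerivComp_iff (hB : IsMetricOn B U) (hU : IsOpen U)
    (hG : ∀ x ∈ U, ∀ i j, G x i j = B x (EuclideanSpace.single i 1) (EuclideanSpace.single j 1))
    {b : Fin n → EuclideanSpace ℝ (Fin n) → ℝ}
    {β : EuclideanSpace ℝ (Fin n) → EuclideanSpace ℝ (Fin n) →L[ℝ] ℝ}
    (hb : ∀ x ∈ U, ∀ i, b i x = β x (EuclideanSpace.single i 1))
    {x : EuclideanSpace ℝ (Fin n)} (hx : x ∈ U) (hβ : DifferentiableAt ℝ β x) (c : ℝ) :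
    (∀ i j, covDerivComp G b i j x = c * G x i j) ↔
      ∀ u v, covDerivForm B β x u v = c * B x u v := by
  refine ⟨fun h => ?_, fun h i j => ?_⟩
  · let P : EuclideanSpace ℝ (Fin n) →ₗ[ℝ] EuclideanSpace ℝ (Fin n) →ₗ[ℝ] ℝ :=
      LinearMap.mk₂ ℝ (covDerivForm B β x) (by intros; simp [covDerivForm]; ring)
        (by intros; simp [covDerivForm]; ring) (by intros; simp [covDerivForm]; ring)
        (by intros; simp [covDerivForm]; ring)
    let Q : EuclideanSpace ℝ (Fin n) →ₗ[ℝ] EuclideanSpace ℝ (Fin n) →ₗ[ℝ] ℝ :=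
      LinearMap.mk₂ ℝ (fun v w => c * B x v w) (by intros; simp; ring) (by intros; simp; ring)
        (by intros; simp; ring) (by intros; simp; ring)
    have hPQ : P = Q := bilin_eq_of_single fun i j => by
      have h1 := h i j
      rw [covDerivComp_eq_covDerivForm hB hU hG hb hx hβ, hG x hx] at h1
      exact h1
    intro v w
    exact congrArg (fun R : EuclideanSpace ℝ (Fin n) →ₗ[ℝ] EuclideanSpace ℝ (Fin n) →ₗ[ℝ] ℝ =>
      R v w) hPQ
  · rw [covDerivComp_eq_covDerivForm hB hU hG hb hx hβ, h, hG x hx]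

end Components

/-! ### Forms with ∇b = cB: norm and potential -/

section ConformalGradient

open Set Filter Topology

set_option maxSynthPendingDepth 3

variable {E : Type*} [NormedAddCommGroup E] [NormedSpace ℝ E] [FiniteDimensional ℝ E]
  {B : E → E →L[ℝ] E →L[ℝ] ℝ} {b : E → E →L[ℝ] ℝ} {U : Set E} {c : ℝ}

/-- The squared norm of the 1-form `b` with respect to the metric `B`. -/
noncomputable def formNormSq (B : E → E →L[ℝ] E →L[ℝ] ℝ) (b : E → E →L[ℝ] ℝ) (x : E) : ℝ :=
  b x ((B x).inverse (b x))

theorem formNormSq_pos (hB : IsMetricOn B U) {x : E} (hx : x ∈ U) (hb : b x ≠ 0) :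
    0 < formNormSq B b x := by
  have h1 := hB.inverse_apply hx (b x)
  have h2 : (B x).inverse (b x) ≠ 0 := fun h0 => hb (by rw [← h1, h0, map_zero])
  have h3 := hB.pos x hx _ h2
  rwa [h1] at h3

theorem contDiffOn_formNormSq (hB : IsMetricOn B U) (hb : ContDiffOn ℝ ∞ b U) :
    ContDiffOn ℝ ∞ (formNormSq B b) U :=
  hb.clm_apply (hB.contDiffOn_inverse.clm_apply hb)

/-- If `∇b = c B`, then `d|b|² = 2 c b`. -/
theorem hasFDerivAt_formNormSq (hB : IsMetricOn B U) (hU : IsOpen U) (hb : ContDiffOn ℝ ∞ b U)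
    (hcov : ∀ x ∈ U, ∀ u v, covDerivForm B b x u v = c * B x u v) {x : E} (hx : x ∈ U) :
    HasFDerivAt (formNormSq B b) ((2 * c) • b x) x := by
  have hbd := ((hb.contDiffAt (hU.mem_nhds hx)).differentiableAt (by simp)).hasFDerivAt
  have hBd := (hB.differentiableAt hU hx).hasFDerivAt
  have hWd := (((hB.contDiffOn_inverse.clm_apply hb).contDiffAt
    (hU.mem_nhds hx)).differentiableAt (by simp)).hasFDerivAt
  set W : E → E := fun x => (B x).inverse (b x) with hW
  have hBW : ∀ y ∈ U, B y (W y) = b y := fun y hy => hB.inverse_apply hy (b y)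
  have h1 : HasFDerivAt (formNormSq B b) _ x := hbd.clm_apply hWd
  refine h1.congr_fderiv ?_
  ext u
  have h2 : fderiv ℝ b x u (W x) = fderiv ℝ B x u (W x) (W x) + B x (fderiv ℝ W x u) (W x) := by
    have h3 := (hBd.clm_apply hWd).congr_of_eventuallyEq (f₁ := b)
      (by filter_upwards [hU.mem_nhds hx] with y hy using (hBW y hy).symm)
    rw [h3.fderiv]
    simp [add_comm]
  have h4 := hcov x hx (W x) u
  -- With W dual to b, two of the three Koszul terms of B(Γ(W, u), W) cancel. Together with `h2` and
  -- the equation for ∇b, all derivatives of B disappear from d|b|².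
  have h5 : b x (lcConn B x (W x) u) = (1 / 2) * fderiv ℝ B x u (W x) (W x) := by
    rw [← hBW x hx, hB.symm x hx, hB.lcConn_spec hx, koszulForm_apply,
      hB.fderiv_symm hU hx (W x) u]
    ring
  have h6 : B x (fderiv ℝ W x u) (W x) = b x (fderiv ℝ W x u) := by
    rw [hB.symm x hx, hBW x hx]
  rw [covDerivForm, h5, hBW x hx] at h4
  simp only [add_apply, ContinuousLinearMap.comp_apply, ContinuousLinearMap.flip_apply, smul_apply,
    smul_eq_mul]
  linarith

/-- Torsion-freeness and the symmetry of B make b closed; the primitive needed when c = 0 comes from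
this. -/
theorem fderiv_form_symm (hB : IsMetricOn B U) (hU : IsOpen U)
    (hcov : ∀ x ∈ U, ∀ u v, covDerivForm B b x u v = c * B x u v) {x : E} (hx : x ∈ U) (u v : E) :
    fderiv ℝ b x u v = fderiv ℝ b x v u := by
  have h1 := hcov x hx u v
  have h2 := hcov x hx v u
  rw [covDerivForm] at h1 h2
  rw [hB.lcConn_symm hU hx, hB.symm x hx] at h1
  linarith

/-- A 1-form with `∇b = c B` is, near a point where it does not vanish, of the form
`(c t + d) dt`. -/
theorem exists_potential (hB : IsMetricOn B U) (hU : IsOpen U) (hb : ContDiffOn ℝ ∞ b U)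
    (hcov : ∀ x ∈ U, ∀ u v, covDerivForm B b x u v = c * B x u v) {x₀ : E} (hx₀ : x₀ ∈ U)
    (hbx₀ : b x₀ ≠ 0) {d : ℝ} (hd : (c ≠ 0 ∧ d = 0) ∨ (c = 0 ∧ formNormSq B b x₀ = d ^ 2)) :
    ∃ (t : E → ℝ) (V : Set E), IsOpen V ∧ x₀ ∈ V ∧ V ⊆ U ∧ ContDiffOn ℝ ∞ t V ∧
      ∀ x ∈ V, c * t x + d ≠ 0 ∧ b x = (c * t x + d) • fderiv ℝ t x ∧
        formNormSq B b x = (c * t x + d) ^ 2 := by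
  have hN := contDiffOn_formNormSq hB hb
  have hdN := fun x hx => hasFDerivAt_formNormSq (x := x) hB hU hb hcov hx
  have hN0 := formNormSq_pos hB hx₀ hbx₀
  obtain ⟨hc, rfl⟩ | ⟨rfl, hd⟩ := hd
  -- Case c ≠ 0, d = 0: with t = |b|/c one has ct = |b|, and d|b|² = 2cb gives dt = b/|b|.
  · refine ⟨fun x => c⁻¹ * √(formNormSq B b x), U ∩ formNormSq B b ⁻¹' Ioi 0,
      hN.continuousOn.isOpen_inter_preimage hU isOpen_Ioi, ⟨hx₀, hN0⟩, inter_subset_left, ?_,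
      fun x hx => ?_⟩
    · exact contDiffOn_const.mul ((hN.mono inter_subset_left).sqrt fun x hx => hx.2.ne')
    · have hpos : 0 < formNormSq B b x := hx.2
      have hsq : 0 < √(formNormSq B b x) := Real.sqrt_pos.2 hpos
      have h1 := ((hdN x hx.1).sqrt hpos.ne').const_mul c⁻¹
      rw [h1.fderiv, add_zero, ← mul_assoc, mul_inv_cancel₀ hc, one_mul]
      refine ⟨hsq.ne', ?_, (Real.sq_sqrt hpos.le).symm⟩
      rw [smul_smul, smul_smul, smul_smul]
      have : √(formNormSq B b x) * (c⁻¹ * (1 / (2 * √(formNormSq B b x)) * (2 * c))) = 1 := by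
        field_simp
      simp only [← mul_assoc] at this ⊢
      rw [this, one_smul]
  -- Case c = 0: |b|² = d² is constant near x₀, and t is a primitive of b/d given by the Poincaré
  -- lemma on a ball. The sign of d is free.
  · have hd0 : d ≠ 0 := by
      rintro rfl
      simp [hd] at hN0
    obtain ⟨r, hr, hrU⟩ := Metric.isOpen_iff.1 hU x₀ hx₀
    obtain ⟨p, hp⟩ := (convex_ball x₀ r).exists_forall_hasFDerivAt_of_fderiv_symmetric
      Metric.isOpen_ball ((hb.mono hrU).differentiableOn (by simp))
      (fun a ha u v => fderiv_form_symm hB hU hcov (hrU ha) u v)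
    have hp' : ContDiffOn ℝ ∞ p (Metric.ball x₀ r) := by
      rw [contDiffOn_infty_iff_fderiv_of_isOpen Metric.isOpen_ball]
      exact ⟨fun x hx => (hp x hx).differentiableAt.differentiableWithinAt,
        (hb.mono hrU).congr fun x hx => (hp x hx).fderiv⟩
    refine ⟨fun x => d⁻¹ * p x, Metric.ball x₀ r, Metric.isOpen_ball, Metric.mem_ball_self hr, hrU,
      contDiffOn_const.mul hp', fun x hx => ?_⟩
    rw [zero_mul, zero_add, ((hp x hx).const_mul d⁻¹).fderiv, smul_smul, mul_inv_cancel₀ hd0,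
      one_smul]
    refine ⟨hd0, rfl, ?_⟩
    rw [← hd]
    refine (convex_ball x₀ r).is_const_of_fderivWithin_eq_zero (𝕜 := ℝ)
      ((hN.mono hrU).differentiableOn (by simp)) (fun y hy => ?_) hx (Metric.mem_ball_self hr)
    rw [fderivWithin_of_isOpen Metric.isOpen_ball hy, (hdN y (hrU hy)).fderiv]
    simp

end ConformalGradient

/-! ### Straightening a vector field along a function -/

section FlowBox

open Set Filter Topology

set_option maxSynthPendingDepth 3

universe u

/-- A smooth vector field `V` with `dt(V) = 1` is straightened by coordinates whose first component
is `t`. -/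
theorem exists_flowBox {E : Type u} [NormedAddCommGroup E] [NormedSpace ℝ E]
    [FiniteDimensional ℝ E] {F : Type*} [NormedAddCommGroup F] [InnerProductSpace ℝ F]
    [FiniteDimensional ℝ F] (hdim : Module.finrank ℝ E = Module.finrank ℝ F + 1)
    {U : Set E} (hU : IsOpen U) {t : E → ℝ} (ht : ContDiffOn ℝ ∞ t U) {V : E → E}
    (hV : ContDiffOn ℝ ∞ V U) (htV : ∀ x ∈ U, fderiv ℝ t x (V x) = 1) {x₀ : E} (hx₀ : x₀ ∈ U) :
    ∃ (s₁ s₂ : ℝ) (ψ : OpenPartialHomeomorph E (ℝ × F)), x₀ ∈ ψ.source ∧ ψ.source ⊆ U ∧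
      ψ.target = Ioo s₁ s₂ ×ˢ univ ∧ ContDiffOn ℝ ∞ ψ ψ.source ∧
      ContDiffOn ℝ ∞ ψ.symm ψ.target ∧ (∀ x ∈ ψ.source, (ψ x).1 = t x) ∧
      ∀ z ∈ ψ.target, fderiv ℝ ψ.symm z (1, 0) = V (ψ.symm z) := by
  have : CompleteSpace E := FiniteDimensional.complete ℝ E
  have : CompleteSpace F := FiniteDimensional.complete ℝ F
  have htd : ∀ x ∈ U, HasFDerivAt t (fderiv ℝ t x) x := fun x hx =>
    ((ht.contDiffAt (hU.mem_nhds hx)).differentiableAt (by simp)).hasFDerivAt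
  obtain ⟨θ, r, hr, hθs, hθ⟩ := exists_smooth_local_flow hU hV hx₀
  have h0r : (0 : ℝ) ∈ Ioo (-r) r := ⟨by linarith, hr⟩
  have hbU : Metric.ball x₀ r ⊆ U := fun x hx => by
    have := (hθ 0 h0r x hx).2.1
    rwa [(hθ 0 h0r x hx).1] at this
  have hbox : IsOpen (Ioo (-r) r ×ˢ Metric.ball x₀ r) := isOpen_Ioo.prod Metric.isOpen_ball
  -- Along the flow t grows at unit speed, because dt(V) = 1.
  have htθ : ∀ s ∈ Ioo (-r) r, ∀ x ∈ Metric.ball x₀ r, t (θ (s, x)) = t x + s := by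
    intro s hs x hx
    have hd : ∀ σ ∈ Ioo (-r) r, HasDerivAt (fun σ => t (θ (σ, x)) - σ) 0 σ := by
      intro σ hσ
      obtain ⟨-, h1, h2⟩ := hθ σ hσ x hx
      have h3 := ((htd _ h1).comp_hasDerivAt σ h2).sub (hasDerivAt_id σ)
      rw [htV _ h1, sub_self] at h3
      exact h3
    have h4 := (convex_Ioo (-r) r).is_const_of_fderivWithin_eq_zero (𝕜 := ℝ)
      (f := fun σ => t (θ (σ, x)) - σ)
      (fun σ hσ => (hd σ hσ).differentiableAt.differentiableWithinAt) (fun σ hσ => by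
        rw [fderivWithin_of_isOpen isOpen_Ioo hσ, (hd σ hσ).hasFDerivAt.fderiv]
        simp) hs h0r
    simp only [(hθ 0 h0r x hx).1, sub_zero] at h4
    linarith
  -- a complement of `V x₀`
  obtain ⟨ι, hι, hιt⟩ : ∃ ι : F →L[ℝ] E, Function.Injective ι ∧ ∀ v, fderiv ℝ t x₀ (ι v) = 0 := by
    have hsurj : LinearMap.range (fderiv ℝ t x₀ : E →ₗ[ℝ] ℝ) = ⊤ := by
      refine LinearMap.range_eq_top.2 fun a => ⟨a • V x₀, ?_⟩
      simp [htV x₀ hx₀]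
    have h1 := LinearMap.finrank_range_add_finrank_ker (fderiv ℝ t x₀ : E →ₗ[ℝ] ℝ)
    rw [hsurj, finrank_top, Module.finrank_self, hdim, add_comm] at h1
    let e := LinearEquiv.ofFinrankEq (R := ℝ) F (LinearMap.ker (fderiv ℝ t x₀ : E →ₗ[ℝ] ℝ))
      (by omega)
    refine ⟨LinearMap.toContinuousLinearMap ((Submodule.subtype _).comp e.toLinearMap),
      fun v w h => ?_, fun v => ?_⟩
    · exact e.injective (Subtype.ext h)
    · exact (e v).2
  -- The slice point x₀ + ι y flows for time s − t(x₀ + ι y), not s, so that θ ∘ q lands exactly on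
  -- the level set t = s.
  let q : ℝ × F → ℝ × E := fun z => (z.1 - t (x₀ + ι z.2), x₀ + ι z.2)
  let O : Set (ℝ × F) := {z | x₀ + ι z.2 ∈ Metric.ball x₀ r}
  have hO : IsOpen O := Metric.isOpen_ball.preimage (by fun_prop)
  have hq : ContDiffOn ℝ ∞ q O := by
    have h1 : ContDiffOn ℝ ∞ (fun z : ℝ × F => x₀ + ι z.2) O := by fun_prop
    exact (contDiffOn_fst.sub (ht.comp h1 fun z hz => hbU hz)).prodMk h1
  let Ω : Set (ℝ × F) := O ∩ q ⁻¹' (Ioo (-r) r ×ˢ Metric.ball x₀ r)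
  have hΩ : IsOpen Ω := hq.continuousOn.isOpen_inter_preimage hO hbox
  let g : ℝ × F → E := θ ∘ q
  have hg : ContDiffOn ℝ ∞ g Ω := hθs.comp (hq.mono inter_subset_left) fun z hz => hz.2
  have hgU : ∀ z ∈ Ω, g z ∈ U := fun z hz => (hθ _ hz.2.1 _ hz.2.2).2.1
  have htg : ∀ z ∈ Ω, t (g z) = z.1 := fun z hz => by
    change t (θ (z.1 - t (x₀ + ι z.2), x₀ + ι z.2)) = _
    rw [htθ _ hz.2.1 _ hz.2.2]
    ring
  have hgd : ∀ z ∈ Ω, HasFDerivAt g (fderiv ℝ g z) z := fun z hz =>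
    ((hg.contDiffAt (hΩ.mem_nhds hz)).differentiableAt (by simp)).hasFDerivAt
  have hgV : ∀ z ∈ Ω, fderiv ℝ g z (1, 0) = V (g z) := by
    intro z hz
    have h1 : HasDerivAt (fun s : ℝ => (s, z.2)) (1, (0 : F)) z.1 :=
      (hasDerivAt_id z.1).prodMk (hasDerivAt_const z.1 z.2)
    have h2 := (hgd z hz).comp_hasDerivAt z.1 h1
    have h3 := (hθ _ hz.2.1 _ hz.2.2).2.2
    have h4 : HasDerivAt (fun s : ℝ => s - t (x₀ + ι z.2)) 1 z.1 :=
      (hasDerivAt_id z.1).sub_const _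
    have h5 := HasDerivAt.scomp z.1 h3 h4
    rw [one_smul] at h5
    exact h2.unique h5
  let z₀ : ℝ × F := (t x₀, 0)
  have hqz₀ : q z₀ = (0, x₀) := by simp [q, z₀]
  have hz₀ : z₀ ∈ Ω := by
    refine ⟨?_, ?_⟩
    · simp [O, z₀, hr]
    · rw [mem_preimage, hqz₀]
      exact ⟨h0r, Metric.mem_ball_self hr⟩
  have hgz₀ : g z₀ = x₀ := by
    change θ (q z₀) = x₀
    rw [hqz₀]
    exact (hθ 0 h0r x₀ (Metric.mem_ball_self hr)).1
  -- Since ι maps into ker dt, the time component of dq vanishes on (0, v), and θ at time 0 is the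
  -- identity.
  have hgι : ∀ v, fderiv ℝ g z₀ (0, v) = ι v := by
    intro v
    have hmem : ((0 : ℝ), x₀) ∈ Ioo (-r) r ×ˢ Metric.ball x₀ r := ⟨h0r, Metric.mem_ball_self hr⟩
    have h1 : HasFDerivAt θ (fderiv ℝ θ (q z₀)) (q z₀) := by
      rw [hqz₀]
      exact ((hθs.contDiffAt (hbox.mem_nhds hmem)).differentiableAt (by simp)).hasFDerivAt
    have h2 : HasFDerivAt (fun z : ℝ × F => x₀ + ι z.2)
        (ι.comp (ContinuousLinearMap.snd ℝ ℝ F)) z₀ :=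
      (ι.hasFDerivAt.comp z₀ hasFDerivAt_snd).const_add x₀
    have h3 : HasFDerivAt t (fderiv ℝ t x₀) (x₀ + ι z₀.2) := by
      simpa [z₀] using htd x₀ hx₀
    have h4 : HasFDerivAt q _ z₀ := (hasFDerivAt_fst.sub (h3.comp z₀ h2)).prodMk h2
    have h5 : HasFDerivAt g _ z₀ := h1.comp z₀ h4
    rw [h5.fderiv]
    have h6 : HasFDerivAt (fun x : E => θ (0, x)) ((fderiv ℝ θ (q z₀)).comp
        ((0 : E →L[ℝ] ℝ).prod (ContinuousLinearMap.id ℝ E))) x₀ := by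
      rw [hqz₀] at h1 ⊢
      exact h1.comp x₀ ((hasFDerivAt_const (0 : ℝ) x₀).prodMk (hasFDerivAt_id x₀))
    have h7 : HasFDerivAt (fun x : E => θ (0, x)) (ContinuousLinearMap.id ℝ E) x₀ := by
      refine (hasFDerivAt_id x₀).congr_of_eventuallyEq ?_
      filter_upwards [Metric.ball_mem_nhds x₀ hr] with x hx using (hθ 0 h0r x hx).1
    have h8 := congrArg (fun l : E →L[ℝ] E => l (ι v)) (h6.unique h7)
    simpa [hιt] using h8
  obtain ⟨A, hA⟩ : ∃ A : (ℝ × F) ≃L[ℝ] E, (A : ℝ × F →L[ℝ] E) = fderiv ℝ g z₀ := by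
    have hinj : Function.Injective (fderiv ℝ g z₀ : ℝ × F →ₗ[ℝ] E) := by
      rw [← LinearMap.ker_eq_bot, LinearMap.ker_eq_bot']
      rintro ⟨a, v⟩ hav
      have h1 : fderiv ℝ g z₀ (a, v) = a • V x₀ + ι v := by
        have : ((a, v) : ℝ × F) = a • (1, 0) + (0, v) := by simp
        rw [this, map_add, map_smul, hgV z₀ hz₀, hgι, hgz₀]
      have h2 : a • V x₀ + ι v = 0 := h1.symm.trans hav
      have h3 := congrArg (fderiv ℝ t x₀) h2
      simp only [map_add, map_smul, htV x₀ hx₀, hιt, smul_eq_mul, mul_one, add_zero,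
        map_zero] at h3
      rw [h3, zero_smul, zero_add] at h2
      have h4 : v = 0 := hι (by rw [h2, map_zero])
      rw [h3, h4]
      rfl
    refine ⟨(LinearEquiv.ofInjectiveOfFinrankEq _ hinj ?_).toContinuousLinearEquiv, by ext <;> rfl⟩
    rw [Module.finrank_prod, Module.finrank_self, hdim, add_comm]
  obtain ⟨e, hez, heΩ, heg, hes⟩ := exists_openPartialHomeomorph_contDiffOn hΩ hg hz₀ A
    (by rw [hA]; exact hgd z₀ hz₀)
  obtain ⟨δ, hδ, hδe⟩ := Metric.isOpen_iff.1 e.open_source z₀ hez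
  let s₁ := t x₀ - δ
  let s₂ := t x₀ + δ
  have hsub : ∀ z : ℝ × F, z.1 ∈ Ioo s₁ s₂ → z.2 ∈ Metric.ball (0 : F) δ → z ∈ e.source := by
    intro z h1 h2
    refine hδe ?_
    rw [Metric.mem_ball, Prod.dist_eq, max_lt_iff]
    refine ⟨?_, h2⟩
    rw [Real.dist_eq, abs_lt]
    constructor <;> simp only [z₀] <;> linarith [h1.1, h1.2]
  -- Reparametrizing the ball by all of F makes the target a full product of an interval with F.
  let β := OpenPartialHomeomorph.univBall (0 : F) δ
  have hβt : β.target = Metric.ball 0 δ := OpenPartialHomeomorph.univBall_target _ hδ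
  have hβs : β.source = univ := OpenPartialHomeomorph.univBall_source _ _
  let P := (OpenPartialHomeomorph.ofSet (Ioo s₁ s₂) isOpen_Ioo).prod β
  let k := P.trans e
  have hks : k.source = Ioo s₁ s₂ ×ˢ univ := by
    ext z
    simp only [k, P, OpenPartialHomeomorph.trans_source, OpenPartialHomeomorph.prod_source,
      OpenPartialHomeomorph.ofSet_source, hβs, mem_inter_iff, mem_prod, mem_univ, and_true,
      mem_preimage, and_iff_left_iff_imp]
    intro hz
    refine hsub _ hz ?_
    rw [← hβt]
    exact β.map_source (by rw [hβs]; trivial)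
  have hkg : ∀ z, k z = g (z.1, β z.2) := fun z => heg _
  have hPm : ∀ z ∈ k.source, (z.1, β z.2) ∈ Ω := fun z hz => heΩ hz.2
  have hkt : k.target ⊆ e.target := fun x hx => hx.1
  refine ⟨s₁, s₂, k.symm, ?_, ?_, hks, ?_, ?_, ?_, ?_⟩
  · refine ⟨?_, ?_⟩
    · rw [← hgz₀, ← heg]
      exact e.map_source hez
    · change e.symm x₀ ∈ P.target
      rw [← hgz₀, ← heg, e.left_inv hez]
      exact ⟨⟨by simp [z₀, s₁, hδ], by simp [z₀, s₂, hδ]⟩, by rw [hβt]; simp [z₀, hδ]⟩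
  · intro x hx
    have h1 := k.right_inv hx
    rw [← h1, hkg]
    exact hgU _ (hPm _ (k.map_target hx))
  · change ContDiffOn ℝ ∞ (P.symm ∘ e.symm) k.target
    have h1 : ContDiffOn ℝ ∞ P.symm P.target := by
      have h2 : ContDiffOn ℝ ∞ (fun z : ℝ × F => β.symm z.2) P.target :=
        OpenPartialHomeomorph.contDiffOn_univBall_symm.comp contDiffOn_snd
          fun z hz => by rw [← hβt]; exact hz.2
      exact contDiffOn_fst.prodMk h2
    exact h1.comp (hes.mono hkt) fun x hx => hx.2
  · have h1 : ContDiff ℝ ∞ fun z : ℝ × F => (z.1, β z.2) :=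
      contDiff_fst.prodMk (OpenPartialHomeomorph.contDiff_univBall.comp contDiff_snd)
    exact (hg.comp h1.contDiffOn hPm).congr fun z _ => hkg z
  · intro x hx
    have h1 := k.right_inv hx
    have h2 := htg _ (hPm _ (k.map_target hx))
    rw [← hkg, h1] at h2
    exact h2.symm
  · intro z hz
    change fderiv ℝ k z (1, 0) = V (k z)
    have h1 : HasFDerivAt (fun z : ℝ × F => (z.1, β z.2)) ((ContinuousLinearMap.fst ℝ ℝ F).prod
        ((fderiv ℝ β z.2).comp (ContinuousLinearMap.snd ℝ ℝ F))) z :=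
      hasFDerivAt_fst.prodMk ((((OpenPartialHomeomorph.contDiff_univBall (n := ⊤)).differentiable
        (by simp) z.2).hasFDerivAt).comp z hasFDerivAt_snd)
    have h2 := HasFDerivAt.comp (g := g) z (hgd _ (hPm z hz)) h1
    rw [show (k : ℝ × F → E) = g ∘ fun z => (z.1, β z.2) from funext hkg, h2.fderiv,
      Function.comp_apply, ← hgV _ (hPm z hz)]
    simp

end FlowBox

/-! ### Local splitting as a warped product -/

section LocalStructure

open Set Filter Topology

set_option maxSynthPendingDepth 3

universe u

/-- If the metric `dt² + k` on `(s₁, s₂) × F` satisfies `∇((c t + d) dt) = c (dt² + k)`, then it is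
the warped product `dt² + (c t + d)² h`. -/
theorem exists_eq_warpedMetric {F : Type*} [NormedAddCommGroup F] [NormedSpace ℝ F]
    [FiniteDimensional ℝ F] {s₁ s₂ c d : ℝ} {t₀ : ℝ} (ht₀ : t₀ ∈ Ioo s₁ s₂)
    (hf : ∀ t ∈ Ioo s₁ s₂, c * t + d ≠ 0)
    {B : ℝ × F → ℝ × F →L[ℝ] ℝ × F →L[ℝ] ℝ} (hB : IsMetricOn B (Ioo s₁ s₂ ×ˢ univ))
    (hB1 : ∀ z ∈ Ioo s₁ s₂ ×ˢ (univ : Set F), ∀ v, B z (1, 0) v = v.1)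
    (hcov : ∀ z ∈ Ioo s₁ s₂ ×ˢ (univ : Set F), ∀ u v,
      covDerivForm B (warpedForm c d) z u v = c * B z u v) :
    ∃ h : F → F →L[ℝ] F →L[ℝ] ℝ, IsMetricOn h univ ∧
      ∀ z ∈ Ioo s₁ s₂ ×ˢ (univ : Set F), B z = warpedMetric c d h z := by
  have hopen : IsOpen (Ioo s₁ s₂ ×ˢ (univ : Set F)) := isOpen_Ioo.prod isOpen_univ
  -- On slice vectors the derivative of f dt vanishes, and B(·, ∂ₜ) is constant there, so ∇b = cB
  -- reduces to ½ f ∂ₜB = cB.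
  have hode : ∀ z ∈ Ioo s₁ s₂ ×ˢ (univ : Set F), ∀ v w : F,
      (c * z.1 + d) * fderiv ℝ B z (1, 0) (0, v) (0, w) = 2 * c * B z (0, v) (0, w) := by
    intro z hz v w
    have h0 : ∀ X : ℝ × F, ∀ u : F, fderiv ℝ B z X (0, u) (1, 0) = 0 := by
      intro X u
      rw [fderiv_apply₂ (hB.differentiableAt hopen hz)]
      have : (fun y => B y (0, u) (1, 0)) =ᶠ[𝓝 z] fun _ => (0 : ℝ) := by
        filter_upwards [hopen.mem_nhds hz] with y hy
        rw [hB.symm y hy, hB1 y hy]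
      rw [this.fderiv_eq]
      simp
    have h1 := hcov z hz (0, v) (0, w)
    have h2 : fderiv ℝ (warpedForm (F := F) c d) z (0, w) (0, v) = 0 := by
      have h3 : HasFDerivAt (fun z : ℝ × F => c * z.1 + d) (c • ContinuousLinearMap.fst ℝ ℝ F) z :=
        (hasFDerivAt_fst.const_mul c).add_const d
      have h4 : fderiv ℝ (warpedForm (F := F) c d) z = _ :=
        (h3.smul_const (ContinuousLinearMap.fst ℝ ℝ F)).fderiv
      rw [h4]
      simp
    rw [covDerivForm, h2, warpedForm_apply, ← hB1 z hz (lcConn B z (0, v) (0, w)),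
      hB.symm z hz (1, 0), hB.lcConn_spec hz,
      koszulForm_apply, h0, h0] at h1
    linarith
  have hconst : ∀ y : F, ∀ s ∈ Ioo s₁ s₂, ∀ v w : F, B (s, y) (0, v) (0, w) =
      (c * s + d) ^ 2 * (((c * t₀ + d) ^ 2)⁻¹ * B (t₀, y) (0, v) (0, w)) := by
    intro y s hs v w
    have hd : ∀ σ ∈ Ioo s₁ s₂, HasDerivAt
        (fun σ => B (σ, y) (0, v) (0, w) / (c * σ + d) ^ 2) 0 σ := by
      intro σ hσ
      have hσz : (σ, y) ∈ Ioo s₁ s₂ ×ˢ (univ : Set F) := ⟨hσ, mem_univ _⟩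
      have h1 : HasDerivAt (fun s : ℝ => (s, y)) (1, (0 : F)) σ :=
        (hasDerivAt_id σ).prodMk (hasDerivAt_const σ y)
      have h2 := (hB.differentiableAt hopen hσz).hasFDerivAt
      have h3 := ((h2.clm_apply (hasFDerivAt_const ((0 : ℝ), v) _)).clm_apply
        (hasFDerivAt_const ((0 : ℝ), w) _)).comp_hasDerivAt σ h1
      have h4 : HasDerivAt (fun σ : ℝ => (c * σ + d) ^ 2) (2 * (c * σ + d) * c) σ := by
        have := (((hasDerivAt_id σ).const_mul c).add_const d).pow 2
        exact HasDerivAt.congr_deriv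
          (this : HasDerivAt (fun σ : ℝ => (c * σ + d) ^ 2) _ σ) (by simp)
      have h5 := h3.div h4 (pow_ne_zero 2 (hf σ hσ))
      refine h5.congr_deriv ?_
      have h6 := hode _ hσz v w
      simp only at h6
      simp only [Function.comp_apply, ContinuousLinearMap.comp_zero, zero_add,
        ContinuousLinearMap.flip_apply]
      rw [div_eq_zero_iff]
      left
      linear_combination (c * σ + d) * h6
    have h7 := (convex_Ioo s₁ s₂).is_const_of_fderivWithin_eq_zero (𝕜 := ℝ)
      (f := fun σ => B (σ, y) (0, v) (0, w) / (c * σ + d) ^ 2)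
      (fun σ hσ => (hd σ hσ).differentiableAt.differentiableWithinAt) (fun σ hσ => by
        rw [fderivWithin_of_isOpen isOpen_Ioo hσ, (hd σ hσ).hasFDerivAt.fderiv]
        simp) hs ht₀
    have h8 := hf s hs
    have h9 := hf t₀ ht₀
    field_simp at h7 ⊢
    linarith
  let inr := ContinuousLinearMap.inr ℝ ℝ F
  -- B/f² is independent of t on slice vectors, so the slice at t₀, rescaled by f(t₀)⁻², determines
  -- the metric everywhere.
  let h : F → F →L[ℝ] F →L[ℝ] ℝ := fun y =>
    ((c * t₀ + d) ^ 2)⁻¹ • (B (t₀, y)).bilinearComp inr inr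
  have hh : ∀ y v w, h y v w = ((c * t₀ + d) ^ 2)⁻¹ * B (t₀, y) (0, v) (0, w) := by
    intro y v w
    simp [h, inr]
  have ht₀z : ∀ y : F, (t₀, y) ∈ Ioo s₁ s₂ ×ˢ (univ : Set F) := fun y => ⟨ht₀, mem_univ _⟩
  refine ⟨h, ⟨?_, fun y _ v w => ?_, fun y _ v hv => ?_⟩, fun z hz => ?_⟩
  · refine contDiffOn_clm_apply.2 fun v => contDiffOn_clm_apply.2 fun w => ?_
    simp only [hh]
    have h1 : ContDiffOn ℝ ∞ (fun y => B (t₀, y)) (univ : Set F) :=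
      hB.contDiffOn.comp (by fun_prop) fun y _ => ht₀z y
    exact contDiffOn_const.mul ((h1.clm_apply contDiffOn_const).clm_apply contDiffOn_const)
  · rw [hh, hh, hB.symm _ (ht₀z y)]
  · rw [hh]
    have h1 := hB.pos _ (ht₀z y) (0, v) (fun h0 => hv (congrArg Prod.snd h0))
    have h2 := hf t₀ ht₀
    positivity
  · refine ContinuousLinearMap.ext fun u => ContinuousLinearMap.ext fun v => ?_
    rw [warpedMetric_apply, hh, ← hconst z.2 z.1 hz.1]
    have hu : u = u.1 • (1, 0) + (0, u.2) := by ext <;> simp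
    have hv : v = v.1 • (1, 0) + (0, v.2) := by ext <;> simp
    have h1 : B z (0, u.2) (1, 0) = 0 := by rw [hB.symm z hz, hB1 z hz]
    conv_lhs => rw [hu, hv]
    simp only [map_add, map_smul, add_apply, smul_apply, hB1 z hz, h1, smul_eq_mul]
    ring

/-- The local structure of a metric `B` with a 1-form `b` such that `∇b = c B`, near a point where
`b` does not vanish. -/
theorem exists_local_warpedMetric {E : Type u} [NormedAddCommGroup E] [NormedSpace ℝ E]
    [FiniteDimensional ℝ E] {F : Type*} [NormedAddCommGroup F] [InnerProductSpace ℝ F]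
    [FiniteDimensional ℝ F] (hdim : Module.finrank ℝ E = Module.finrank ℝ F + 1)
    {B : E → E →L[ℝ] E →L[ℝ] ℝ} {b : E → E →L[ℝ] ℝ} {U : Set E} {c d : ℝ}
    (hB : IsMetricOn B U) (hU : IsOpen U) (hb : ContDiffOn ℝ ∞ b U)
    (hcov : ∀ x ∈ U, ∀ u v, covDerivForm B b x u v = c * B x u v) {x₀ : E} (hx₀ : x₀ ∈ U)
    (hbx₀ : b x₀ ≠ 0) (hd : (c ≠ 0 ∧ d = 0) ∨ (c = 0 ∧ formNormSq B b x₀ = d ^ 2)) :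
    ∃ (s₁ s₂ : ℝ) (ψ : OpenPartialHomeomorph E (ℝ × F)) (h : F → F →L[ℝ] F →L[ℝ] ℝ),
      x₀ ∈ ψ.source ∧ ψ.source ⊆ U ∧ ψ.target = Ioo s₁ s₂ ×ˢ univ ∧
      ContDiffOn ℝ ∞ ψ ψ.source ∧ ContDiffOn ℝ ∞ ψ.symm ψ.target ∧
      (∀ t ∈ Ioo s₁ s₂, c * t + d ≠ 0) ∧
      (∀ x ∈ ψ.source, ∀ u, b x u = warpedForm c d (ψ x) (fderiv ℝ ψ x u)) ∧
      IsMetricOn h univ ∧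
      IsIsometryOn B ψ.source (warpedMetric c d h) (Ioo s₁ s₂ ×ˢ univ) ψ := by
  obtain ⟨t, U', hU', hx₀', hUU', ht, htp⟩ := exists_potential hB hU hb hcov hx₀ hbx₀ hd
  have hB' := hB.mono hUU'
  have htd := ht.fderiv_of_isOpen hU' (m := ∞) (by simp)
  -- V is the gradient of t; b = f dt and |b|² = f² with f ≠ 0 force dt(V) = |dt|² = 1.
  let V : E → E := fun x => (B x).inverse (fderiv ℝ t x)
  have hV : ContDiffOn ℝ ∞ V U' := hB'.contDiffOn_inverse.clm_apply htd
  have hBV : ∀ x ∈ U', B x (V x) = fderiv ℝ t x := fun x hx => hB'.inverse_apply hx _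
  have htV : ∀ x ∈ U', fderiv ℝ t x (V x) = 1 := by
    intro x hx
    obtain ⟨h1, h2, h3⟩ := htp x hx
    rw [formNormSq, h2, map_smul, smul_apply, map_smul, smul_eq_mul, smul_eq_mul,
      ← mul_assoc, ← sq] at h3
    exact mul_left_cancel₀ (pow_ne_zero 2 h1) (h3.trans (mul_one _).symm)
  obtain ⟨s₁, s₂, ψ, hxs, hsU, htgt, hψ, hψs, hψt, hψV⟩ :=
    exists_flowBox (F := F) hdim hU' ht hV htV hx₀'
  have hψd : ∀ x ∈ ψ.source, HasFDerivAt ψ (fderiv ℝ ψ x) x := fun x hx =>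
    ((hψ.contDiffAt (ψ.open_source.mem_nhds hx)).differentiableAt (by simp)).hasFDerivAt
  have hψsd : ∀ z ∈ ψ.target, HasFDerivAt ψ.symm (fderiv ℝ ψ.symm z) z := fun z hz =>
    ((hψs.contDiffAt (ψ.open_target.mem_nhds hz)).differentiableAt (by simp)).hasFDerivAt
  have hinv1 : ∀ x ∈ ψ.source, ∀ u, fderiv ℝ ψ.symm (ψ x) (fderiv ℝ ψ x u) = u := by
    intro x hx u
    have h1 := (hψsd _ (ψ.map_source hx)).comp x (hψd x hx)
    have h2 : HasFDerivAt (ψ.symm ∘ ψ) (ContinuousLinearMap.id ℝ E) x := by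
      refine (hasFDerivAt_id x).congr_of_eventuallyEq ?_
      filter_upwards [ψ.open_source.mem_nhds hx] with y hy using ψ.left_inv hy
    exact congrArg (fun l : E →L[ℝ] E => l u) (h1.unique h2)
  have hinv2 : ∀ z ∈ ψ.target, ∀ v, fderiv ℝ ψ (ψ.symm z) (fderiv ℝ ψ.symm z v) = v := by
    intro z hz v
    have h1 := (hψd _ (ψ.map_target hz)).comp z (hψsd z hz)
    have h2 : HasFDerivAt (ψ ∘ ψ.symm) (ContinuousLinearMap.id ℝ (ℝ × F)) z := by
      refine (hasFDerivAt_id z).congr_of_eventuallyEq ?_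
      filter_upwards [ψ.open_target.mem_nhds hz] with y hy using ψ.right_inv hy
    exact congrArg (fun l : ℝ × F →L[ℝ] ℝ × F => l v) (h1.unique h2)
  have hdt : ∀ x ∈ ψ.source, ∀ u, fderiv ℝ t x u = (fderiv ℝ ψ x u).1 := by
    intro x hx u
    have h1 : HasFDerivAt t ((ContinuousLinearMap.fst ℝ ℝ F).comp (fderiv ℝ ψ x)) x := by
      refine (hasFDerivAt_fst.comp x (hψd x hx)).congr_of_eventuallyEq ?_
      filter_upwards [ψ.open_source.mem_nhds hx] with y hy using (hψt y hy).symm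
    rw [h1.fderiv]
    rfl
  have hsym : ∀ z ∈ ψ.target, ψ.symm z ∈ ψ.source := fun z hz => ψ.map_target hz
  let B' : ℝ × F → ℝ × F →L[ℝ] ℝ × F →L[ℝ] ℝ := fun z =>
    (B (ψ.symm z)).bilinearComp (fderiv ℝ ψ.symm z) (fderiv ℝ ψ.symm z)
  have hB'a : ∀ z u v, B' z u v =
      B (ψ.symm z) (fderiv ℝ ψ.symm z u) (fderiv ℝ ψ.symm z v) := fun z u v => rfl
  have hB'm : IsMetricOn B' ψ.target := by
    refine ⟨?_, fun z hz u v => ?_, fun z hz u hu => ?_⟩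
    · refine contDiffOn_clm_apply.2 fun u => contDiffOn_clm_apply.2 fun v => ?_
      simp only [hB'a]
      have h1 := hψs.fderiv_of_isOpen ψ.open_target (m := ∞) (by simp)
      have h2 : ContDiffOn ℝ ∞ (fun z => B (ψ.symm z)) ψ.target :=
        hB'.contDiffOn.comp hψs fun z hz => hsU (hsym z hz)
      exact (h2.clm_apply (h1.clm_apply contDiffOn_const)).clm_apply
        (h1.clm_apply contDiffOn_const)
    · rw [hB'a, hB'a, hB'.symm _ (hsU (hsym z hz))]
    · refine hB'.pos _ (hsU (hsym z hz)) _ fun h0 => hu ?_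
      have h1 : fderiv ℝ ψ.symm z u = 0 := h0
      rw [← hinv2 z hz u, h1, map_zero]
  have hbψ : ∀ x ∈ ψ.source, ∀ u, b x u = warpedForm c d (ψ x) (fderiv ℝ ψ x u) := by
    intro x hx u
    rw [warpedForm_apply, hψt x hx, ← hdt x hx, (htp x (hsU hx)).2.1]
    rfl
  have hiso : IsIsometryOn B' ψ.target B U' ψ.symm :=
    ⟨ψ.open_target, hU', hB'm, hB', hψs, fun z hz => hsU (hsym z hz), fun z _ u v => hB'a z u v⟩
  have hcov' : ∀ z ∈ ψ.target, ∀ u v, covDerivForm B' (warpedForm c d) z u v = c * B' z u v := by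
    intro z hz u v
    rw [hiso.covDerivForm_eq (by rw [hdim, Module.finrank_prod, Module.finrank_self, add_comm])
      (b' := b) (fun y hy => (hb.contDiffAt (hU.mem_nhds (hUU' hy))).differentiableAt (by simp))
      (fun z hz u => ?_) hz, hcov _ (hUU' (hsU (hsym z hz))), hB'a]
    rw [hbψ _ (hsym z hz), hinv2 z hz, ψ.right_inv hz]
  -- ∂ₜ corresponds to the gradient of t, so it is a unit vector orthogonal to the slices: there are
  -- no cross terms.
  have hB1 : ∀ z ∈ ψ.target, ∀ v, B' z (1, 0) v = v.1 := by
    intro z hz v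
    rw [hB'a, hψV z hz, hBV _ (hsU (hsym z hz)), hdt _ (hsym z hz), hinv2 z hz]
  have hx₀z := ψ.map_source hxs
  have hf : ∀ s ∈ Ioo s₁ s₂, c * s + d ≠ 0 := by
    intro s hs
    have hz : (s, (0 : F)) ∈ ψ.target := by rw [htgt]; exact ⟨hs, mem_univ _⟩
    have h1 := (htp _ (hsU (hsym _ hz))).1
    rwa [← hψt _ (hsym _ hz), ψ.right_inv hz] at h1
  rw [htgt] at hB'm hcov' hB1 hx₀z
  obtain ⟨h, hh, hBh⟩ := exists_eq_warpedMetric hx₀z.1 hf hB'm hB1 hcov'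
  refine ⟨s₁, s₂, ψ, h, hxs, hsU.trans hUU', htgt, hψ, hψs, hf, hbψ, hh, ψ.open_source,
    isOpen_Ioo.prod isOpen_univ, hB'.mono hsU, isMetricOn_warpedMetric hh hf, hψ, ?_, ?_⟩
  · rw [← htgt]
    exact ψ.mapsTo
  · intro x hx u v
    have h1 := ψ.map_source hx
    rw [← hBh _ (by rwa [← htgt]), hB'a, ψ.left_inv hx, hinv1 x hx, hinv1 x hx]

end LocalStructure

/-! ### Metrics and 1-forms of a manifold read in a chart -/

section ManifoldCharts

set_option linter.unusedSectionVars false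

open Set Filter Topology

set_option maxSynthPendingDepth 3

variable {n : ℕ} {M : Type*} [TopologicalSpace M]
  [ChartedSpace (EuclideanSpace ℝ (Fin n)) M] [IsManifold (𝓡 n) ∞ M]
  {e : OpenPartialHomeomorph M (EuclideanSpace ℝ (Fin n))}

/-- The metric `g` in the chart `e`. -/
noncomputable def chartMetric (g : SmoothMetric n M)
    (e : OpenPartialHomeomorph M (EuclideanSpace ℝ (Fin n))) (x : EuclideanSpace ℝ (Fin n)) :
    EuclideanSpace ℝ (Fin n) →L[ℝ] EuclideanSpace ℝ (Fin n) →L[ℝ] ℝ :=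
  let T : EuclideanSpace ℝ (Fin n) →L[ℝ] EuclideanSpace ℝ (Fin n) :=
    mfderiv 𝓘(ℝ, EuclideanSpace ℝ (Fin n)) (𝓡 n) e.symm x
  let G : EuclideanSpace ℝ (Fin n) →L[ℝ] EuclideanSpace ℝ (Fin n) →L[ℝ] ℝ := g.inner (e.symm x)
  G.bilinearComp T T

theorem chartMetric_apply (g : SmoothMetric n M)
    (e : OpenPartialHomeomorph M (EuclideanSpace ℝ (Fin n))) (x u v : EuclideanSpace ℝ (Fin n)) :
    chartMetric g e x u v = g.inner (e.symm x)
      (mfderiv 𝓘(ℝ, EuclideanSpace ℝ (Fin n)) (𝓡 n) e.symm x u)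
      (mfderiv 𝓘(ℝ, EuclideanSpace ℝ (Fin n)) (𝓡 n) e.symm x v) := rfl

/-- The 1-form `β` in the chart `e`. -/
noncomputable def chartForm (β : SmoothOneForm n M)
    (e : OpenPartialHomeomorph M (EuclideanSpace ℝ (Fin n))) (x : EuclideanSpace ℝ (Fin n)) :
    EuclideanSpace ℝ (Fin n) →L[ℝ] ℝ :=
  (β.toFun (e.symm x)).comp (mfderiv 𝓘(ℝ, EuclideanSpace ℝ (Fin n)) (𝓡 n) e.symm x)

theorem chartForm_apply (β : SmoothOneForm n M)
    (e : OpenPartialHomeomorph M (EuclideanSpace ℝ (Fin n))) (x u : EuclideanSpace ℝ (Fin n)) :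
    chartForm β e x u = β.toFun (e.symm x)
      (mfderiv 𝓘(ℝ, EuclideanSpace ℝ (Fin n)) (𝓡 n) e.symm x u) := rfl

section

variable (he : e ∈ IsManifold.maximalAtlas (𝓡 n) ∞ M)
include he

theorem mdifferentiableAt_chart {q : M} (hq : q ∈ e.source) :
    MDifferentiableAt (𝓡 n) 𝓘(ℝ, EuclideanSpace ℝ (Fin n)) e q :=
  (contMDiffAt_of_mem_maximalAtlas he hq).mdifferentiableAt (by simp)

theorem mdifferentiableAt_chart_symm {x : EuclideanSpace ℝ (Fin n)} (hx : x ∈ e.target) :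
    MDifferentiableAt 𝓘(ℝ, EuclideanSpace ℝ (Fin n)) (𝓡 n) e.symm x :=
  (contMDiffAt_symm_of_mem_maximalAtlas he hx).mdifferentiableAt (by simp)

theorem mfderiv_chart_symm_apply {x : EuclideanSpace ℝ (Fin n)} (hx : x ∈ e.target)
    (u : EuclideanSpace ℝ (Fin n)) :
    mfderiv (𝓡 n) 𝓘(ℝ, EuclideanSpace ℝ (Fin n)) e (e.symm x)
      (mfderiv 𝓘(ℝ, EuclideanSpace ℝ (Fin n)) (𝓡 n) e.symm x u) = u := by
  have h1 := (mdifferentiableAt_chart he (e.map_target hx)).hasMFDerivAt.comp x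
    (mdifferentiableAt_chart_symm he hx).hasMFDerivAt
  have h2 : HasMFDerivAt 𝓘(ℝ, EuclideanSpace ℝ (Fin n)) 𝓘(ℝ, EuclideanSpace ℝ (Fin n))
      (e ∘ e.symm) x (ContinuousLinearMap.id ℝ _) := by
    refine (hasMFDerivAt_id x).congr_of_eventuallyEq ?_
    filter_upwards [e.open_target.mem_nhds hx] with y hy using e.right_inv hy
  exact congrArg (fun l : EuclideanSpace ℝ (Fin n) →L[ℝ] EuclideanSpace ℝ (Fin n) => l u)
    (hasMFDerivAt_unique h1 h2)

theorem mfderiv_symm_chart_apply {q : M} (hq : q ∈ e.source) (v : TangentSpace (𝓡 n) q) :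
    (mfderiv 𝓘(ℝ, EuclideanSpace ℝ (Fin n)) (𝓡 n) e.symm (e q)
      (mfderiv (𝓡 n) 𝓘(ℝ, EuclideanSpace ℝ (Fin n)) e q v) : EuclideanSpace ℝ (Fin n)) = v := by
  have h1 := (mdifferentiableAt_chart_symm he (e.map_source hq)).hasMFDerivAt.comp q
    (mdifferentiableAt_chart he hq).hasMFDerivAt
  have h2 : HasMFDerivAt (𝓡 n) (𝓡 n) (e.symm ∘ e) q (ContinuousLinearMap.id ℝ _) := by
    refine (hasMFDerivAt_id q).congr_of_eventuallyEq ?_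
    filter_upwards [e.open_source.mem_nhds hq] with y hy using e.left_inv hy
  exact congrArg (fun l : EuclideanSpace ℝ (Fin n) →L[ℝ] EuclideanSpace ℝ (Fin n) => l v)
    (hasMFDerivAt_unique h1 h2)

/-- This is the tangent map of the inverse chart applied to a constant field. Evaluating the bundle
sections g and β on such fields yields smooth components. -/
theorem contMDiffOn_coordinate_field (u : EuclideanSpace ℝ (Fin n)) :
    ContMDiffOn 𝓘(ℝ, EuclideanSpace ℝ (Fin n)) (𝓡 n).tangent ∞
      (fun x => (⟨e.symm x, mfderiv 𝓘(ℝ, EuclideanSpace ℝ (Fin n)) (𝓡 n) e.symm x u⟩ :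
        TangentBundle (𝓡 n) M)) e.target := by
  have h1 : ContMDiff 𝓘(ℝ, EuclideanSpace ℝ (Fin n)) 𝓘(ℝ, EuclideanSpace ℝ (Fin n)).tangent ∞
      (fun x => (⟨x, u⟩ : TangentBundle 𝓘(ℝ, EuclideanSpace ℝ (Fin n))
        (EuclideanSpace ℝ (Fin n)))) :=
    contMDiff_vectorSpace_iff_contDiff.2 contDiff_const
  have h2 := (contMDiffOn_symm_of_mem_maximalAtlas he).contMDiffOn_tangentMapWithin (m := ∞)
    (by simp) e.open_target.uniqueMDiffOn
  refine (h2.comp h1.contMDiffOn fun x hx => hx).congr fun x hx => ?_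
  simp only [Function.comp_apply, tangentMapWithin]
  rw [mfderivWithin_of_isOpen e.open_target hx]

theorem contDiffOn_chartMetric (g : SmoothMetric n M) :
    ContDiffOn ℝ ∞ (chartMetric g e) e.target := by
  refine contDiffOn_clm_apply.2 fun u => contDiffOn_clm_apply.2 fun v => ?_
  simp only [chartMetric_apply]
  rw [← contMDiffOn_iff_contDiffOn]
  have h1 := (g.contMDiff.contMDiffOn (s := univ)).comp (contMDiffOn_symm_of_mem_maximalAtlas he)
    (fun x _ => mem_univ _)
  have h2 := ContMDiffOn.clm_bundle_apply₂ (E₃ := Trivial M ℝ) (F₃ := ℝ) h1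
    (contMDiffOn_coordinate_field he u) (contMDiffOn_coordinate_field he v)
  intro x hx
  have h3 := h2 x hx
  simp only [contMDiffWithinAt_totalSpace] at h3
  exact h3.2

theorem contDiffOn_chartForm (β : SmoothOneForm n M) :
    ContDiffOn ℝ ∞ (chartForm β e) e.target := by
  refine contDiffOn_clm_apply.2 fun u => ?_
  simp only [chartForm_apply]
  rw [← contMDiffOn_iff_contDiffOn]
  have h1 := (β.contMDiff.contMDiffOn (s := univ)).comp (contMDiffOn_symm_of_mem_maximalAtlas he)
    (fun x _ => mem_univ _)
  have h2 := ContMDiffOn.clm_bundle_apply (E₂ := Trivial M ℝ) (F₂ := ℝ) h1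
    (contMDiffOn_coordinate_field he u)
  intro x hx
  have h3 := h2 x hx
  simp only [contMDiffWithinAt_totalSpace] at h3
  exact h3.2

theorem isMetricOn_chartMetric (g : SmoothMetric n M) : IsMetricOn (chartMetric g e) e.target where
  contDiffOn := contDiffOn_chartMetric he g
  symm := fun x _ u v => g.symm (e.symm x) _ _
  pos := fun x hx u hu => by
    refine g.pos (e.symm x) (mfderiv 𝓘(ℝ, EuclideanSpace ℝ (Fin n)) (𝓡 n) e.symm x u)
      fun h0 => hu ?_
    have h1 := mfderiv_chart_symm_apply he hx u
    rw [h0] at h1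
    exact h1.symm.trans (ContinuousLinearMap.map_zero
      (mfderiv (𝓡 n) 𝓘(ℝ, EuclideanSpace ℝ (Fin n)) e (e.symm x)))

theorem forall_ricciComp_chart_iff (g : SmoothMetric n M) (κ : ℝ)
    {x : EuclideanSpace ℝ (Fin n)} (hx : x ∈ e.target) :
    (∀ i j, ricciComp (metricComp g e) i j x = κ * metricComp g e x i j) ↔
      ∀ v w, ricciForm (lcConn (chartMetric g e)) x v w = κ * chartMetric g e x v w :=
  forall_ricciComp_iff (isMetricOn_chartMetric he g) e.open_target (fun _ _ _ _ => rfl) hx κ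

theorem forall_covDerivComp_chart_iff (g : SmoothMetric n M) (β : SmoothOneForm n M) (c : ℝ)
    {x : EuclideanSpace ℝ (Fin n)} (hx : x ∈ e.target) :
    (∀ i j, covDerivComp (metricComp g e) (formComp β e) i j x = c * metricComp g e x i j) ↔
      ∀ u v, covDerivForm (chartMetric g e) (chartForm β e) x u v = c * chartMetric g e x u v :=
  forall_covDerivComp_iff (isMetricOn_chartMetric he g) e.open_target (fun _ _ _ _ => rfl)
    (fun _ _ _ => rfl) hx (((contDiffOn_chartForm he β).contDiffAt
      (e.open_target.mem_nhds hx)).differentiableAt (by simp)) c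

end

theorem ricciFlat_iff_ricciEq_zero (g : SmoothMetric n M) : RicciFlat g ↔ RicciEq g 0 := by
  simp [RicciFlat, RicciEq]

end ManifoldCharts

/-! ### A metric on Euclidean space as a Riemannian metric on a manifold -/

section ModelSpaceMetric

open Set Filter Topology Bornology

set_option maxSynthPendingDepth 3

variable {m : ℕ} {k : EuclideanSpace ℝ (Fin m) → EuclideanSpace ℝ (Fin m) →L[ℝ]
    EuclideanSpace ℝ (Fin m) →L[ℝ] ℝ}

/-- On the compact unit sphere the form is at least some a > 0, so the set lies within radius 1/√a.
This supplies the boundedness field of the bundled metric. -/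
theorem isVonNBounded_setOf_lt_one {F : Type*} [NormedAddCommGroup F] [NormedSpace ℝ F]
    [FiniteDimensional ℝ F] (b : F →L[ℝ] F →L[ℝ] ℝ) (hb : ∀ v, v ≠ 0 → 0 < b v v) :
    IsVonNBounded ℝ {v : F | b v v < 1} := by
  obtain ⟨a, ha, hab⟩ := (isCompact_sphere (0 : F) 1).exists_forall_le' (f := fun v => b v v)
    (by fun_prop) (a := 0) fun v hv => hb v (ne_zero_of_mem_unit_sphere ⟨v, hv⟩)
  rw [NormedSpace.isVonNBounded_iff, isBounded_iff_forall_norm_le]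
  refine ⟨√(1 / a), fun v hv => ?_⟩
  by_cases hv0 : v = 0
  · simp [hv0]
  have hn : 0 < ‖v‖ := norm_pos_iff.2 hv0
  have h1 := hab (‖v‖⁻¹ • v) (by simp [norm_smul, hn.ne'])
  simp only [map_smul, smul_apply, smul_eq_mul] at h1
  refine Real.le_sqrt_of_sq_le ?_
  have h2 : b v v < 1 := hv
  rw [le_div_iff₀ ha]
  rw [← mul_assoc, ← mul_inv, ← div_eq_inv_mul, le_div_iff₀ (by positivity)] at h1
  nlinarith

/-- A bilinear form on a Euclidean space, as a form on a tangent space. -/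
noncomputable def tangentBilin (k : EuclideanSpace ℝ (Fin m) → EuclideanSpace ℝ (Fin m) →L[ℝ]
    EuclideanSpace ℝ (Fin m) →L[ℝ] ℝ) (x : EuclideanSpace ℝ (Fin m)) :
    TangentSpace (𝓡 m) x →L[ℝ] TangentSpace (𝓡 m) x →L[ℝ] ℝ := k x

/-- Over a model space the trivializations act as the identity on fibres. This is the inner layer of
`trivializationAt_tangentBilin`, which turns smoothness of a section into smoothness of k. -/
theorem trivializationAt_cotangent (x y : EuclideanSpace ℝ (Fin m))
    (l : TangentSpace (𝓡 m) y →L[ℝ] ℝ) :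
    (trivializationAt (EuclideanSpace ℝ (Fin m) →L[ℝ] ℝ)
      (fun b : EuclideanSpace ℝ (Fin m) => TangentSpace (𝓡 m) b →L[ℝ] ℝ) x ⟨y, l⟩).2 = l := by
  have h := hom_trivializationAt_apply (RingHom.id ℝ) (F₁ := EuclideanSpace ℝ (Fin m))
    (E₁ := fun b : EuclideanSpace ℝ (Fin m) => TangentSpace (𝓡 m) b) (F₂ := ℝ)
    (E₂ := Trivial (EuclideanSpace ℝ (Fin m)) ℝ) x ⟨y, l⟩
  refine (congrArg Prod.snd h).trans ?_
  ext v
  simp [ContinuousLinearMap.inCoordinates]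
  rfl

theorem trivializationAt_tangentBilin (x y : EuclideanSpace ℝ (Fin m)) :
    (trivializationAt (EuclideanSpace ℝ (Fin m) →L[ℝ] EuclideanSpace ℝ (Fin m) →L[ℝ] ℝ)
      (fun b : EuclideanSpace ℝ (Fin m) =>
        TangentSpace (𝓡 m) b →L[ℝ] TangentSpace (𝓡 m) b →L[ℝ] ℝ) x
      ⟨y, tangentBilin k y⟩).2 = k y := by
  rw [hom_trivializationAt_apply]
  ext v w
  simp only [ContinuousLinearMap.inCoordinates, TangentBundle.symmL_model_space,
    ContinuousLinearMap.comp_apply]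
  have hmem : y ∈ (trivializationAt (EuclideanSpace ℝ (Fin m) →L[ℝ] ℝ)
      (fun b : EuclideanSpace ℝ (Fin m) => TangentSpace (𝓡 m) b →L[ℝ] ℝ) x).baseSet := by
    simp [hom_trivializationAt_baseSet]
    exact mem_univ _
  rw [Trivialization.continuousLinearMapAt_apply, Trivialization.linearMapAt_apply, if_pos hmem]
  exact congrArg (fun l : EuclideanSpace ℝ (Fin m) →L[ℝ] ℝ => l w)
    (trivializationAt_cotangent x y (tangentBilin k y v))

/-- A smooth metric on a Euclidean space, as a Riemannian metric on a manifold. -/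
noncomputable def IsMetricOn.toSmoothMetric (hk : IsMetricOn k univ) :
    SmoothMetric m (EuclideanSpace ℝ (Fin m)) where
  inner x := tangentBilin k x
  symm x v w := hk.symm x (mem_univ x) v w
  pos x v hv := hk.pos x (mem_univ x) v hv
  isVonNBounded x := isVonNBounded_setOf_lt_one (k x) (hk.pos x (mem_univ x))
  contMDiff := by
    intro x
    rw [contMDiffAt_section]
    simp only [trivializationAt_tangentBilin]
    exact (hk.contDiffOn.contDiffAt univ_mem).contMDiffAt

/-- Each inverse chart is an isometry into Euclidean space with the metric k, so the equation in
standard coordinates gives it in every chart. -/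
theorem IsMetricOn.ricciEq_toSmoothMetric (hk : IsMetricOn k univ) {κ : ℝ}
    (hκ : ∀ x v w, ricciForm (lcConn k) x v w = κ * k x v w) :
    RicciEq hk.toSmoothMetric κ := by
  intro e he x hx
  rw [forall_ricciComp_chart_iff he _ _ hx]
  have hiso : IsIsometryOn (chartMetric hk.toSmoothMetric e) e.target k univ e.symm :=
    ⟨e.open_target, isOpen_univ, isMetricOn_chartMetric he _, hk,
      contMDiffOn_iff_contDiffOn.1 (contMDiffOn_symm_of_mem_maximalAtlas he),
      fun _ _ => mem_univ _, fun y _ u v => by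
        rw [chartMetric_apply, mfderiv_eq_fderiv]; rfl⟩
  intro v w
  rw [hiso.ricciForm_eq rfl hx, hκ, hiso.pullback x hx]

end ModelSpaceMetric

/-! ### From Ricci flatness and ∇β = cα to the warped product -/

section LocalWarpedProduct

open Set Filter Topology

set_option maxSynthPendingDepth 3

variable {n : ℕ} {M : Type*} [TopologicalSpace M]
  [ChartedSpace (EuclideanSpace ℝ (Fin n)) M] [IsManifold (𝓡 n) ∞ M]
  {g : SmoothMetric n M} {β : SmoothOneForm n M} {c d : ℝ}
  {e : OpenPartialHomeomorph M (EuclideanSpace ℝ (Fin n))}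

theorem cast_finrank_sub_one (hn : 3 ≤ n) :
    (Module.finrank ℝ (EuclideanSpace ℝ (Fin (n - 1))) : ℝ) - 1 = n - 2 := by
  rw [finrank_euclideanSpace_fin, Nat.cast_sub (by omega)]
  push_cast
  ring

theorem finrank_eq_finrank_prod (hn : 3 ≤ n) : Module.finrank ℝ (EuclideanSpace ℝ (Fin n)) =
    Module.finrank ℝ (ℝ × EuclideanSpace ℝ (Fin (n - 1))) := by
  rw [Module.finrank_prod, finrank_euclideanSpace_fin, finrank_euclideanSpace_fin,
    Module.finrank_self]
  omega

theorem chartMetric_mfderiv (g : SmoothMetric n M)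
    (he : e ∈ IsManifold.maximalAtlas (𝓡 n) ∞ M) {q : M} (hq : q ∈ e.source)
    (v w : TangentSpace (𝓡 n) q) :
    chartMetric g e (e q)
      (mfderiv (𝓡 n) 𝓘(ℝ, EuclideanSpace ℝ (Fin n)) e q v : EuclideanSpace ℝ (Fin n))
      (mfderiv (𝓡 n) 𝓘(ℝ, EuclideanSpace ℝ (Fin n)) e q w : EuclideanSpace ℝ (Fin n)) =
    g.inner q v w := by
  let G : M → EuclideanSpace ℝ (Fin n) →L[ℝ] EuclideanSpace ℝ (Fin n) →L[ℝ] ℝ :=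
    fun q => g.inner q
  exact (congrArg₂ (fun a b => G (e.symm (e q)) a b) (mfderiv_symm_chart_apply he hq v)
    (mfderiv_symm_chart_apply he hq w)).trans (congrArg (fun r => G r v w) (e.left_inv hq))

theorem chartForm_mfderiv (β : SmoothOneForm n M)
    (he : e ∈ IsManifold.maximalAtlas (𝓡 n) ∞ M) {q : M} (hq : q ∈ e.source)
    (v : TangentSpace (𝓡 n) q) :
    chartForm β e (e q)
      (mfderiv (𝓡 n) 𝓘(ℝ, EuclideanSpace ℝ (Fin n)) e q v : EuclideanSpace ℝ (Fin n)) =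
    β.toFun q v := by
  let b : M → EuclideanSpace ℝ (Fin n) →L[ℝ] ℝ := fun q => β.toFun q
  exact (congrArg (b (e.symm (e q))) (mfderiv_symm_chart_apply he hq v)).trans
    (congrArg (fun r => b r v) (e.left_inv hq))

theorem chartForm_ne_zero (he : e ∈ IsManifold.maximalAtlas (𝓡 n) ∞ M) {q : M}
    (hq : q ∈ e.source) : chartForm β e (e q) ≠ 0 ↔ β.toFun q ≠ 0 := by
  refine not_congr ⟨fun h => ?_, fun h => ?_⟩
  · ext v
    exact (chartForm_mfderiv β he hq v).symm.trans
      (congrArg (fun l : EuclideanSpace ℝ (Fin n) →L[ℝ] ℝ => l _) h)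
  · ext u
    have h1 : β.toFun (e.symm (e q)) = 0 := by rw [e.left_inv hq]; exact h
    rw [chartForm_apply, h1]
    rfl

theorem isLocalWarpedProductAt_of_ricciFlat (hn : 3 ≤ n) (hR : RicciFlat g)
    (hC : CovDerivEq g β c) (he : e ∈ IsManifold.maximalAtlas (𝓡 n) ∞ M) {p : M}
    (hp : p ∈ e.source) (hβ : β.toFun p ≠ 0)
    (hd : (c ≠ 0 ∧ d = 0) ∨
      (c = 0 ∧ formNormSq (chartMetric g e) (chartForm β e) (e p) = d ^ 2)) :
    IsLocalWarpedProductAt g β c d p := by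
  have hdim := finrank_eq_finrank_prod hn
  obtain ⟨s₁, s₂, ψ, h, hpψ, hψe, hψt, hψ, hψs, hI, hbψ, hh, hiso⟩ :=
    exists_local_warpedMetric (F := EuclideanSpace ℝ (Fin (n - 1)))
      (by rw [hdim, Module.finrank_prod, Module.finrank_self, add_comm])
      (isMetricOn_chartMetric he g) e.open_target (contDiffOn_chartForm he β)
      (fun x hx => (forall_covDerivComp_chart_iff he g β c hx).1 (hC e he x hx))
      (e.map_source hp) ((chartForm_ne_zero he hp).2 hβ) hd
  have hψd : ∀ x ∈ ψ.source, HasFDerivAt ψ (fderiv ℝ ψ x) x := fun x hx =>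
    ((hψ.contDiffAt (ψ.open_source.mem_nhds hx)).differentiableAt (by simp)).hasFDerivAt
  -- Above every y lies a point of the chart with first coordinate that of p. Evaluating the
  -- vanishing Ricci tensor there on vectors corresponding to (0, v) and (0, w) gives 0 = Ric_h −
  -- (n−2)c²h.
  have hric : ∀ y v w, ricciForm (lcConn h) y v w = (((n : ℝ) - 2) * c ^ 2) * h y v w := by
    intro y v w
    have hz : ((ψ (e p)).1, y) ∈ Ioo s₁ s₂ ×ˢ (univ : Set (EuclideanSpace ℝ (Fin (n - 1)))) := by
      have h1 := ψ.map_source hpψ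
      rw [hψt] at h1
      exact ⟨h1.1, mem_univ _⟩
    have hx := ψ.map_target (hψt.symm ▸ hz)
    have hψx := ψ.right_inv (hψt.symm ▸ hz)
    obtain ⟨L, hL⟩ := hiso.exists_equiv hdim hx
    have h1 := hiso.ricciForm_eq hdim hx (L.symm (0, v)) (L.symm (0, w))
    rw [(forall_ricciComp_chart_iff he g 0 (hψe hx)).1
      ((ricciFlat_iff_ricciEq_zero g).1 hR e he _ (hψe hx)), hψx, ← hL,
      ContinuousLinearEquiv.coe_coe, L.apply_symm_apply, L.apply_symm_apply,
      ricciForm_warpedMetric hh isOpen_univ isOpen_Ioo hI hz, cast_finrank_sub_one hn] at h1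
    linarith
  have hsm : ContMDiffOn (𝓡 n) 𝓘(ℝ, EuclideanSpace ℝ (Fin n)) ∞ e e.source :=
    contMDiffOn_of_mem_maximalAtlas he
  have hsrc : (e.trans ψ).source = e.source ∩ e ⁻¹' ψ.source := e.trans_source ψ
  have htgt : (e.trans ψ).target = ψ.target := by
    rw [OpenPartialHomeomorph.trans_target, inter_eq_left]
    exact fun z hz => hψe (ψ.map_target hz)
  have hΦ : ContMDiffOn (𝓡 n) (𝓘(ℝ, ℝ).prod (𝓡 (n - 1))) ∞ (fun q => ((ψ (e q)).1, (ψ (e q)).2))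
      (e.source ∩ e ⁻¹' ψ.source) := by
    have h1 : ContMDiffOn (𝓡 n) 𝓘(ℝ, ℝ) ∞ (fun x => (ψ x).1) ψ.source :=
      (contDiff_fst.comp_contDiffOn hψ).contMDiffOn
    have h2 : ContMDiffOn (𝓡 n) (𝓡 (n - 1)) ∞ (fun x => (ψ x).2) ψ.source :=
      (contDiff_snd.comp_contDiffOn hψ).contMDiffOn
    have h3 := hsm.mono (inter_subset_left (t := e ⁻¹' ψ.source))
    exact (h1.comp h3 fun q hq => hq.2).prodMk (h2.comp h3 fun q hq => hq.2)
  have hΦs : ContMDiffOn (𝓘(ℝ, ℝ).prod (𝓡 (n - 1))) (𝓡 n) ∞ (fun z => e.symm (ψ.symm z))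
      ψ.target := by
    have h1 : ContMDiffOn (𝓘(ℝ, ℝ).prod (𝓡 (n - 1))) 𝓘(ℝ, EuclideanSpace ℝ (Fin n)) ∞ ψ.symm
        ψ.target := by
      rw [← modelWithCornersSelf_prod, chartedSpaceSelf_prod]
      exact hψs.contMDiffOn
    exact (contMDiffOn_symm_of_mem_maximalAtlas he).comp h1 fun z hz => hψe (ψ.map_target hz)
  have hT2 : T2Space (EuclideanSpace ℝ (Fin (n - 1))) := inferInstance
  refine ⟨EuclideanSpace ℝ (Fin (n - 1)), inferInstance, hT2, inferInstance,
    inferInstance, inferInstance, hh.toSmoothMetric, s₁, s₂, e.trans ψ,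
    hh.ricciEq_toSmoothMetric hric, ?_, htgt.trans hψt, ?_, ?_, ?_⟩
  · rw [hsrc]
    exact ⟨hp, hpψ⟩
  · rw [hsrc]
    exact hΦ
  · rw [htgt]
    exact hΦs
  · intro q hq
    rw [hsrc] at hq
    have hed := (mdifferentiableAt_chart he hq.1).hasMFDerivAt
    have h1 : HasMFDerivAt (𝓡 n) 𝓘(ℝ, ℝ) (fun z => (ψ (e z)).1) q
        (((ContinuousLinearMap.fst ℝ ℝ _).comp (fderiv ℝ ψ (e q))).comp
          (mfderiv (𝓡 n) 𝓘(ℝ, EuclideanSpace ℝ (Fin n)) e q)) :=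
      ((hasFDerivAt_fst.comp _ (hψd _ hq.2)).hasMFDerivAt).comp q hed
    have h2 : HasMFDerivAt (𝓡 n) (𝓡 (n - 1)) (fun z => (ψ (e z)).2) q
        (((ContinuousLinearMap.snd ℝ ℝ _).comp (fderiv ℝ ψ (e q))).comp
          (mfderiv (𝓡 n) 𝓘(ℝ, EuclideanSpace ℝ (Fin n)) e q)) :=
      ((hasFDerivAt_snd.comp _ (hψd _ hq.2)).hasMFDerivAt).comp q hed
    intro dt dπ
    have hdt : dt = _ := h1.mfderiv
    have hdπ : dπ = _ := h2.mfderiv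
    rw [hdt, hdπ]
    refine ⟨fun v w => ?_, fun v => ?_⟩
    · refine (chartMetric_mfderiv g he hq.1 v w).symm.trans ?_
      refine (hiso.pullback (e q) hq.2 _ _).trans ?_
      rw [warpedMetric_apply]
      rfl
    · refine (chartForm_mfderiv β he hq.1 v).symm.trans ?_
      refine (hbψ (e q) hq.2 _).trans ?_
      rw [warpedForm_apply]
      rfl

end LocalWarpedProduct

/-! ### From the warped product back to Ricci flatness and ∇β = cα -/

section WarpedProductGeometry

open Set Filter Topology

set_option maxSynthPendingDepth 3

variable {n : ℕ} {M : Type*} [TopologicalSpace M]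
  [ChartedSpace (EuclideanSpace ℝ (Fin n)) M] [IsManifold (𝓡 n) ∞ M]
  {g : SmoothMetric n M} {β : SmoothOneForm n M} {c d : ℝ} {p : M}
  {e : OpenPartialHomeomorph M (EuclideanSpace ℝ (Fin n))}

/-- In charts, a warped product structure is an isometry onto a warped product metric. -/
theorem IsLocalWarpedProductAt.exists_isIsometryOn (hn : 3 ≤ n)
    (H : IsLocalWarpedProductAt g β c d p) (he : e ∈ IsManifold.maximalAtlas (𝓡 n) ∞ M)
    (hp : p ∈ e.source) :
    ∃ (W : Set (EuclideanSpace ℝ (Fin n)))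
      (φ : EuclideanSpace ℝ (Fin n) → ℝ × EuclideanSpace ℝ (Fin (n - 1)))
      (I : Set ℝ) (V : Set (EuclideanSpace ℝ (Fin (n - 1))))
      (k : EuclideanSpace ℝ (Fin (n - 1)) → EuclideanSpace ℝ (Fin (n - 1)) →L[ℝ]
        EuclideanSpace ℝ (Fin (n - 1)) →L[ℝ] ℝ),
      IsOpen I ∧ IsOpen V ∧ IsMetricOn k V ∧ (∀ t ∈ I, c * t + d ≠ 0) ∧
      (∀ y ∈ V, ∀ v w, ricciForm (lcConn k) y v w = (((n : ℝ) - 2) * c ^ 2) * k y v w) ∧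
      IsIsometryOn (chartMetric g e) W (warpedMetric c d k) (I ×ˢ V) φ ∧ e p ∈ W ∧
      ∀ x ∈ W, ∀ u, chartForm β e x u = warpedForm c d (φ x) (fderiv ℝ φ x u) := by
  obtain ⟨N, _, _, _, _, _, h, s₁, s₂, Φ, hRic, hpΦ, -, hΦ, -, hprod⟩ := H
  -- As n > 1, some nonzero v has dt(v) = 0. If the warping factor vanished, v would have length
  -- zero.
  have hne : ∀ q ∈ Φ.source, c * (Φ q).1 + d ≠ 0 := by
    intro q hq h0
    obtain ⟨h1, -⟩ := hprod q hq
    let dt : EuclideanSpace ℝ (Fin n) →L[ℝ] ℝ := mfderiv (𝓡 n) 𝓘(ℝ, ℝ) (fun z => (Φ z).1) q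
    have h2 : LinearMap.ker (dt : EuclideanSpace ℝ (Fin n) →ₗ[ℝ] ℝ) ≠ ⊥ :=
      LinearMap.ker_ne_bot_of_finrank_lt (by
        rw [finrank_euclideanSpace_fin, Module.finrank_self]; omega)
    obtain ⟨v, hv, hv0⟩ := Submodule.exists_mem_ne_zero_of_ne_bot h2
    have h3 : (0 : ℝ) < dt v * dt v + (c * (Φ q).1 + d) ^ 2 * _ :=
      (g.pos q v hv0).trans_eq (h1 v v)
    rw [h0, show dt v = 0 from hv] at h3
    simp at h3
  let eN := chartAt (EuclideanSpace ℝ (Fin (n - 1))) (Φ p).2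
  have heN : eN ∈ IsManifold.maximalAtlas (𝓡 (n - 1)) ∞ N :=
    IsManifold.chart_mem_maximalAtlas _
  let φ : EuclideanSpace ℝ (Fin n) → ℝ × EuclideanSpace ℝ (Fin (n - 1)) :=
    fun x => ((Φ (e.symm x)).1, eN (Φ (e.symm x)).2)
  let W : Set (EuclideanSpace ℝ (Fin n)) :=
    e.target ∩ e.symm ⁻¹' (Φ.source ∩ Φ ⁻¹' (univ ×ˢ eN.source))
  have hW : IsOpen W := e.isOpen_inter_preimage_symm
    (Φ.isOpen_inter_preimage (isOpen_univ.prod eN.open_source))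
  have hΦ1 : ContMDiffOn (𝓡 n) 𝓘(ℝ, ℝ) ∞ (fun q => (Φ q).1) Φ.source :=
    contMDiff_fst.comp_contMDiffOn hΦ
  have hΦ2 : ContMDiffOn (𝓡 n) (𝓡 (n - 1)) ∞ (fun q => (Φ q).2) Φ.source :=
    contMDiff_snd.comp_contMDiffOn hΦ
  have hs : ContMDiffOn 𝓘(ℝ, EuclideanSpace ℝ (Fin n)) (𝓡 n) ∞ e.symm W :=
    (contMDiffOn_symm_of_mem_maximalAtlas he).mono inter_subset_left
  have hφ : ContDiffOn ℝ ∞ φ W := by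
    have h1 : ContDiffOn ℝ ∞ (fun x => (Φ (e.symm x)).1) W :=
      contMDiffOn_iff_contDiffOn.1 (hΦ1.comp hs fun x hx => hx.2.1)
    have h2 : ContDiffOn ℝ ∞ (fun x => eN (Φ (e.symm x)).2) W :=
      contMDiffOn_iff_contDiffOn.1 ((contMDiffOn_of_mem_maximalAtlas heN).comp
        (hΦ2.comp hs fun x hx => hx.2.1) fun x hx => hx.2.2.2)
    exact h1.prodMk h2
  have hφd : ∀ x ∈ W, ∀ u, fderiv ℝ φ x u =
      (mfderiv (𝓡 n) 𝓘(ℝ, ℝ) (fun z => (Φ z).1) (e.symm x)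
        (mfderiv 𝓘(ℝ, EuclideanSpace ℝ (Fin n)) (𝓡 n) e.symm x u),
      mfderiv (𝓡 (n - 1)) 𝓘(ℝ, EuclideanSpace ℝ (Fin (n - 1))) eN (Φ (e.symm x)).2
        (mfderiv (𝓡 n) (𝓡 (n - 1)) (fun z => (Φ z).2) (e.symm x)
          (mfderiv 𝓘(ℝ, EuclideanSpace ℝ (Fin n)) (𝓡 n) e.symm x u))) := by
    intro x hx u
    have hsd := (mdifferentiableAt_chart_symm he hx.1).hasMFDerivAt
    have hsrc := Φ.open_source.mem_nhds hx.2.1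
    have h1 := (((hΦ1.contMDiffAt hsrc).mdifferentiableAt (by simp)).hasMFDerivAt.comp x
      hsd).hasFDerivAt
    have h2 := ((mdifferentiableAt_chart heN hx.2.2.2).hasMFDerivAt.comp x
      (((hΦ2.contMDiffAt hsrc).mdifferentiableAt (by simp)).hasMFDerivAt.comp x hsd)).hasFDerivAt
    exact congrArg
      (fun l : EuclideanSpace ℝ (Fin n) →L[ℝ] ℝ × EuclideanSpace ℝ (Fin (n - 1)) => l u)
      (HasFDerivAt.fderiv (f := φ) (h1.prodMk h2))
  have hk := isMetricOn_chartMetric heN h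
  -- An isometry into the product is enough, so the interval is replaced by the whole set where the
  -- warping factor is nonzero.
  have hI : IsOpen {t : ℝ | c * t + d ≠ 0} := isOpen_ne_fun (by fun_prop) continuous_const
  refine ⟨W, φ, {t | c * t + d ≠ 0}, eN.target, chartMetric h eN, hI, eN.open_target, hk,
    fun t ht => ht, fun y hy => (forall_ricciComp_chart_iff heN h _ hy).1 (hRic eN heN y hy),
    ⟨hW, hI.prod eN.open_target, (isMetricOn_chartMetric he g).mono inter_subset_left,
      isMetricOn_warpedMetric hk fun t ht => ht, hφ,
      fun x hx => ⟨hne _ hx.2.1, eN.map_source hx.2.2.2⟩, fun x hx u v => ?_⟩,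
    ⟨e.map_source hp, ?_⟩, fun x hx u => ?_⟩
  · rw [chartMetric_apply, (hprod _ hx.2.1).1, warpedMetric_apply, hφd x hx, hφd x hx]
    refine congrArg (fun r => _ + _ * r) (chartMetric_mfderiv h heN hx.2.2.2 _ _).symm
  · rw [mem_preimage, e.left_inv hp]
    exact ⟨hpΦ, mem_univ _, mem_chart_source _ _⟩
  · rw [chartForm_apply, (hprod _ hx.2.1).2, warpedForm_apply, hφd x hx]
    rfl

/-- In product coordinates β takes the value ct + d ≠ 0 on ∂ₜ. -/
theorem IsLocalWarpedProductAt.toFun_ne_zero (hn : 3 ≤ n)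
    (H : IsLocalWarpedProductAt g β c d p) : β.toFun p ≠ 0 := by
  have he : chartAt (EuclideanSpace ℝ (Fin n)) p ∈ IsManifold.maximalAtlas (𝓡 n) ∞ M :=
    IsManifold.chart_mem_maximalAtlas p
  have hp := mem_chart_source (EuclideanSpace ℝ (Fin n)) p
  obtain ⟨W, φ, I, V, k, hI, hV, hk, hne, hRic, hiso, hpW, hform⟩ :=
    H.exists_isIsometryOn hn he hp
  obtain ⟨L, hL⟩ := hiso.exists_equiv (finrank_eq_finrank_prod hn) hpW
  rw [← chartForm_ne_zero he hp]
  intro h0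
  have h1 := hform _ hpW (L.symm (1, 0))
  rw [← hL, h0, ContinuousLinearEquiv.coe_coe, L.apply_symm_apply, warpedForm_apply] at h1
  have h2 := hne _ (hiso.mapsTo hpW).1
  simp at h1
  exact h2 h1.symm

/-- By tensoriality the claim moves to the warped product, where the Einstein constant (n−2)c² of
the fibre cancels the correction term. -/
theorem ricciFlat_of_isLocalWarpedProductAt (hn : 3 ≤ n)
    (H : ∀ p, ∃ d, IsLocalWarpedProductAt g β c d p) : RicciFlat g := by
  rw [ricciFlat_iff_ricciEq_zero]
  intro e he x hx
  rw [forall_ricciComp_chart_iff he g 0 hx]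
  intro v w
  obtain ⟨d, hd⟩ := H (e.symm x)
  obtain ⟨W, φ, I, V, k, hI, hV, hk, hne, hRic, hiso, hpW, hform⟩ :=
    hd.exists_isIsometryOn hn he (e.map_target hx)
  rw [e.right_inv hx] at hpW
  have hφ := hiso.mapsTo hpW
  rw [hiso.ricciForm_eq (finrank_eq_finrank_prod hn) hpW,
    ricciForm_warpedMetric hk hV hI hne hφ, cast_finrank_sub_one hn, hRic _ hφ.2]
  ring

theorem covDerivEq_of_isLocalWarpedProductAt (hn : 3 ≤ n)
    (H : ∀ p, ∃ d, IsLocalWarpedProductAt g β c d p) : CovDerivEq g β c := by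
  intro e he x hx
  rw [forall_covDerivComp_chart_iff he g β c hx]
  intro v w
  obtain ⟨d, hd⟩ := H (e.symm x)
  obtain ⟨W, φ, I, V, k, hI, hV, hk, hne, hRic, hiso, hpW, hform⟩ :=
    hd.exists_isIsometryOn hn he (e.map_target hx)
  rw [e.right_inv hx] at hpW
  rw [hiso.covDerivForm_eq (finrank_eq_finrank_prod hn)
      (fun y _ => differentiableAt_warpedForm c d y) hform hpW,
    covDerivForm_warpedForm hk hV hne (hiso.mapsTo hpW), hiso.pullback x hpW]

end WarpedProductGeometry

/-! ### The norm of β and the choice of d -/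

section NormOfForm

open Set Filter Topology

set_option maxSynthPendingDepth 3

variable {n : ℕ} {M : Type*} [TopologicalSpace M]
  [ChartedSpace (EuclideanSpace ℝ (Fin n)) M] [IsManifold (𝓡 n) ∞ M]
  {g : SmoothMetric n M} {β : SmoothOneForm n M} {c : ℝ}
  {e : OpenPartialHomeomorph M (EuclideanSpace ℝ (Fin n))}

theorem formNormSq_eq_of_dual {E : Type*} [NormedAddCommGroup E] [NormedSpace ℝ E]
    [FiniteDimensional ℝ E] {B : E → E →L[ℝ] E →L[ℝ] ℝ} {b : E → E →L[ℝ] ℝ} {U : Set E} {x w : E}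
    (hB : IsMetricOn B U) (hx : x ∈ U) (hw : B x w = b x) : formNormSq B b x = b x w := by
  obtain ⟨L, hL⟩ := hB.exists_equiv hx
  have h1 := hB.inverse_apply hx (b x)
  rw [← hw, ← hL] at h1
  rw [formNormSq, ← hw, ← hL]
  exact congrArg _ (L.injective h1)

/-- The squared norm of a 1-form with respect to a Riemannian metric. -/
noncomputable def oneFormNormSq (g : SmoothMetric n M) (β : SmoothOneForm n M) (q : M) : ℝ :=
  formNormSq (fun _ : EuclideanSpace ℝ (Fin n) => g.inner q) (fun _ => β.toFun q) 0

/-- The differential of the chart sends the vector dual to β to the vector dual to its chart form,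
so the norm is independent of the chart and can be compared between distant points. -/
theorem formNormSq_chart (he : e ∈ IsManifold.maximalAtlas (𝓡 n) ∞ M) {q : M}
    (hq : q ∈ e.source) :
    formNormSq (chartMetric g e) (chartForm β e) (e q) = oneFormNormSq g β q := by
  have hG : IsMetricOn (fun _ : EuclideanSpace ℝ (Fin n) =>
      (g.inner q : EuclideanSpace ℝ (Fin n) →L[ℝ] EuclideanSpace ℝ (Fin n) →L[ℝ] ℝ)) univ :=
    ⟨contDiffOn_const, fun _ _ => g.symm q, fun _ _ => g.pos q⟩
  let b : EuclideanSpace ℝ (Fin n) →L[ℝ] ℝ := β.toFun q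
  let D : M → EuclideanSpace ℝ (Fin n) →L[ℝ] EuclideanSpace ℝ (Fin n) := fun r =>
    mfderiv (𝓡 n) 𝓘(ℝ, EuclideanSpace ℝ (Fin n)) e r
  obtain ⟨w, hw⟩ : ∃ w : EuclideanSpace ℝ (Fin n), (g.inner q : EuclideanSpace ℝ (Fin n) →L[ℝ]
      EuclideanSpace ℝ (Fin n) →L[ℝ] ℝ) w = b :=
    ⟨_, hG.inverse_apply (mem_univ 0) b⟩
  have hDw : chartMetric g e (e q) (D q w) = chartForm β e (e q) := by
    ext u
    obtain ⟨v, rfl⟩ : ∃ v, D q v = u :=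
      ⟨_, (congrArg (fun r => D r _) (e.left_inv hq).symm).trans
        (mfderiv_chart_symm_apply he (e.map_source hq) u)⟩
    exact (chartMetric_mfderiv g he hq w v).trans
      ((congrArg (fun l : EuclideanSpace ℝ (Fin n) →L[ℝ] ℝ => l v) hw).trans
        (chartForm_mfderiv β he hq v).symm)
  rw [formNormSq_eq_of_dual (isMetricOn_chartMetric he g) (e.map_source hq) hDw]
  exact (chartForm_mfderiv β he hq w).trans
    (formNormSq_eq_of_dual (b := fun _ => b) hG (mem_univ 0) hw).symm

theorem oneFormNormSq_pos {q : M} (hβ : β.toFun q ≠ 0) : 0 < oneFormNormSq g β q := by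
  have he : chartAt (EuclideanSpace ℝ (Fin n)) q ∈ IsManifold.maximalAtlas (𝓡 n) ∞ M :=
    IsManifold.chart_mem_maximalAtlas q
  have hq := mem_chart_source (EuclideanSpace ℝ (Fin n)) q
  rw [← formNormSq_chart he hq]
  exact formNormSq_pos (isMetricOn_chartMetric he g) (OpenPartialHomeomorph.map_source _ hq)
    ((chartForm_ne_zero he hq).2 hβ)

/-- A parallel 1-form has locally constant norm. -/
theorem isLocallyConstant_oneFormNormSq (hC : CovDerivEq g β 0) :
    IsLocallyConstant (oneFormNormSq g β) := by
  rw [IsLocallyConstant.iff_eventually_eq]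
  intro p
  set e := chartAt (EuclideanSpace ℝ (Fin n)) p
  have he : e ∈ IsManifold.maximalAtlas (𝓡 n) ∞ M := IsManifold.chart_mem_maximalAtlas p
  have hp : p ∈ e.source := mem_chart_source (EuclideanSpace ℝ (Fin n)) p
  obtain ⟨ε, hε, hball⟩ := Metric.isOpen_iff.1 e.open_target _ (e.map_source hp)
  have hd : ∀ x ∈ Metric.ball (e p) ε,
      HasFDerivAt (formNormSq (chartMetric g e) (chartForm β e))
        (0 : EuclideanSpace ℝ (Fin n) →L[ℝ] ℝ) x := by
    intro x hx
    have h1 := hasFDerivAt_formNormSq (isMetricOn_chartMetric he g) e.open_target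
      (contDiffOn_chartForm he β)
      (fun x hx => (forall_covDerivComp_chart_iff he g β 0 hx).1 (hC e he x hx)) (hball hx)
    simpa using h1
  filter_upwards [e.open_source.mem_nhds hp, (e.continuousAt hp).preimage_mem_nhds
    (Metric.ball_mem_nhds (e p) hε)] with q hq hqb
  rw [← formNormSq_chart he hq, ← formNormSq_chart he hp]
  exact (convex_ball (e p) ε).is_const_of_fderivWithin_eq_zero
    (fun x hx => (hd x hx).differentiableAt.differentiableWithinAt)
    (fun x hx => by
      rw [fderivWithin_of_isOpen Metric.isOpen_ball hx, (hd x hx).fderiv])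
    hqb (Metric.mem_ball_self hε)

theorem isLocalWarpedProductAt_of_oneFormNormSq (hn : 3 ≤ n) (hR : RicciFlat g)
    (hC : CovDerivEq g β c) {p : M} (hβ : β.toFun p ≠ 0) {d : ℝ}
    (hd : (c ≠ 0 ∧ d = 0) ∨ (c = 0 ∧ oneFormNormSq g β p = d ^ 2)) :
    IsLocalWarpedProductAt g β c d p := by
  have he : chartAt (EuclideanSpace ℝ (Fin n)) p ∈ IsManifold.maximalAtlas (𝓡 n) ∞ M :=
    IsManifold.chart_mem_maximalAtlas p
  have hp := mem_chart_source (EuclideanSpace ℝ (Fin n)) p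
  rw [← formNormSq_chart he hp] at hd
  exact isLocalWarpedProductAt_of_ricciFlat hn hR hC he hp hβ hd

theorem exists_isLocalWarpedProductAt (hn : 3 ≤ n) (hR : RicciFlat g) (hC : CovDerivEq g β c)
    {p : M} (hβ : β.toFun p ≠ 0) :
    ∃ d : ℝ, c ^ 2 + d ^ 2 ≠ 0 ∧ IsLocalWarpedProductAt g β c d p := by
  by_cases hc : c = 0
  · have hpos := oneFormNormSq_pos (g := g) hβ
    have hsq := Real.sq_sqrt hpos.le
    exact ⟨√(oneFormNormSq g β p), by rw [hsq]; positivity,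
      isLocalWarpedProductAt_of_oneFormNormSq hn hR hC hβ (Or.inr ⟨hc, hsq.symm⟩)⟩
  · exact ⟨0, by positivity,
      isLocalWarpedProductAt_of_oneFormNormSq hn hR hC hβ (Or.inl ⟨hc, rfl⟩)⟩

/-- For c ≠ 0 the choice d = 0 already ignores the point. For c = 0 the condition d² = |β|² is the
same at all points, since a locally constant norm is constant on a connected space. -/
theorem exists_forall_isLocalWarpedProductAt [PreconnectedSpace M] (hn : 3 ≤ n)
    (hR : RicciFlat g) (hC : CovDerivEq g β c) :
    ∃ d : ℝ, c ^ 2 + d ^ 2 ≠ 0 ∧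
      ∀ p : M, β.toFun p ≠ 0 → IsLocalWarpedProductAt g β c d p := by
  by_cases hc : c = 0
  · by_cases hβ : ∃ p : M, β.toFun p ≠ 0
    · obtain ⟨p₀, hp₀⟩ := hβ
      have hpos := oneFormNormSq_pos (g := g) hp₀
      have hsq := Real.sq_sqrt hpos.le
      refine ⟨√(oneFormNormSq g β p₀), by rw [hsq]; positivity, fun p hp =>
        isLocalWarpedProductAt_of_oneFormNormSq hn hR hC hp (Or.inr ⟨hc, ?_⟩)⟩
      rw [hsq]
      exact (isLocallyConstant_oneFormNormSq (hc ▸ hC)).apply_eq_of_preconnectedSpace p p₀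
    · push Not at hβ
      -- Here β vanishes identically, so any nonzero d would do.
      exact ⟨1, by positivity, fun p hp => absurd (hβ p) hp⟩
  · exact ⟨0, by positivity, fun p hp =>
      isLocalWarpedProductAt_of_oneFormNormSq hn hR hC hp (Or.inl ⟨hc, rfl⟩)⟩

end NormOfForm

theorem proposition4p2 {n : ℕ} (hn : 3 ≤ n) {M : Type*} [TopologicalSpace M]
    [ChartedSpace (EuclideanSpace ℝ (Fin n)) M] [IsManifold (𝓡 n) ∞ M]
    (g : SmoothMetric n M) (β : SmoothOneForm n M) (c : ℝ) :
    ((RicciFlat g ∧ CovDerivEq g β c ∧ ∀ p : M, β.toFun p ≠ 0) ↔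
      ∀ p : M, ∃ d : ℝ, c ^ 2 + d ^ 2 ≠ 0 ∧ IsLocalWarpedProductAt g β c d p) ∧
    (RicciFlat g → CovDerivEq g β c → ∀ p : M, β.toFun p ≠ 0 →
      ∃ d : ℝ, c ^ 2 + d ^ 2 ≠ 0 ∧ IsLocalWarpedProductAt g β c d p) ∧
    (PreconnectedSpace M → RicciFlat g → CovDerivEq g β c →
      ∃ d : ℝ, c ^ 2 + d ^ 2 ≠ 0 ∧
        ∀ p : M, β.toFun p ≠ 0 → IsLocalWarpedProductAt g β c d p) := by
  refine ⟨⟨fun ⟨hR, hC, hβ⟩ p => exists_isLocalWarpedProductAt hn hR hC (hβ p), fun H => ?_⟩,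
    fun hR hC p hβ => exists_isLocalWarpedProductAt hn hR hC hβ,
    fun _ hR hC => exists_forall_isLocalWarpedProductAt hn hR hC⟩
  have H' : ∀ p, ∃ d, IsLocalWarpedProductAt g β c d p := fun p => (H p).imp fun _ h => h.2
  exact ⟨ricciFlat_of_isLocalWarpedProductAt hn H', covDerivEq_of_isLocalWarpedProductAt hn H',
    fun p => (H' p).elim fun _ h => h.toFun_ne_zero hn⟩
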